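/- Let $\mathcal{F}$ be a field of characteristic $2$, let $p\in\mathcal{F}[x]$ be a monic irreducible polynomial of degree $d$, and let $\mathcal{F}(p)=\mathcal{F}[x]/(p)$. For a field $K$ of characteristic $2$, let $W(K)$ be the Witt ring of nondegenerate symmetric bilinear forms over $K$, let $I(K)\subset W(K)$ be the fundamental ideal (the classes of even-dimensional forms), let $W_q(K)$ be the Witt group of nonsingular quadratic forms over $K$ (those with nondegenerate polar form), regarded as a $W(K)$-module through the tensor product, and for $m\ge 1$ let $I_q^m(K)=I(K)^{m-1}\cdot W_q(K)\subseteq W_q(K)$ be the subgroup generated by the products of an element of $I(K)^{m-1}$ and an element of $W_q(K)$, where $I(K)^0=W(K)$; thus $I_q^1(K)=W_q(K)$. Let $t_p:\mathcal{F}(p)\to\mathcal{F}$ be the $\mathcal{F}$-linear map with $t_p(x^i)=0$ for $0\le i\le d-2$ and $t_p(x^{d-1})=1$, and let $t_p':W_q(\mathcal{F}(p))\to W_q(\mathcal{F})$ be the Scharlau transfer induced by $t_p$: the group homomorphism that sends the class of a nonsingular quadratic form $q$ on an $\mathcal{F}(p)$-vector space $V$ to the class of $t_p\circ q$ on $V$,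 viewed as an $\mathcal{F}$-vector space. Then $$t_p'\bigl(I_q^m(\mathcal{F}(p))\bigr)\subseteq I_q^m(\mathcal{F})\qquad\text{for all } m\ge 1 .$$ -/

import Mathlib

noncomputable section

namespace WittTheory

open TensorProduct
open LinearMap (BilinForm)

universe u

section Forms

variable {F : Type*} [Field F]
variable {V : Type*} [AddCommGroup V] [Module F V]
variable {W : Type*} [AddCommGroup W] [Module F W]
variable {V' : Type*} [AddCommGroup V'] [Module F V']
variable {W' : Type*} [AddCommGroup W'] [Module F W']

/-- The orthogonal sum of two bilinear forms. -/
def bilinSum (B : BilinForm F V) (C : BilinForm F W) : BilinForm F (V × W) :=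
  B.compl₁₂ (LinearMap.fst F V W) (LinearMap.fst F V W) +
    C.compl₁₂ (LinearMap.snd F V W) (LinearMap.snd F V W)

@[simp]
theorem bilinSum_apply (B : BilinForm F V) (C : BilinForm F W) (x y : V × W) :
    bilinSum B C x y = B x.1 y.1 + C x.2 y.2 := rfl

theorem nondeg_of_symm {B : BilinForm F V} (hs : ∀ x y, B x y = B y x)
    (h : ∀ x, (∀ y, B x y = 0) → x = 0) : B.Nondegenerate :=
  ⟨h, fun y hy => h y fun x => by rw [hs]; exact hy x⟩

theorem bilinSum_nondegenerate {B : BilinForm F V} {C : BilinForm F W}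
    (hB : B.Nondegenerate) (hC : C.Nondegenerate) : (bilinSum B C).Nondegenerate := by
  constructor
  · intro x hx
    refine Prod.ext (hB.1 _ fun y => ?_) (hC.1 _ fun y => ?_)
    · simpa using hx (y, 0)
    · simpa using hx (0, y)
  · intro x hx
    refine Prod.ext (hB.2 _ fun y => ?_) (hC.2 _ fun y => ?_)
    · simpa using hx (y, 0)
    · simpa using hx (0, y)

theorem tmul_apply (B : BilinForm F V) (C : BilinForm F W) (v v' : V) (w w' : W) :
    B.tmul C (v ⊗ₜ w) (v' ⊗ₜ w') = B v v' * C w w' := by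
  rw [LinearMap.BilinForm.tensorDistrib_tmul, smul_eq_mul, mul_comm]

theorem tmul_separatingLeft [FiniteDimensional F V] [FiniteDimensional F W]
    {B : BilinForm F V} {C : BilinForm F W}
    (hB : B.Nondegenerate) (hC : C.Nondegenerate) :
    ∀ x, (∀ y, B.tmul C x y = 0) → x = 0 := by
  have key : ∀ x, B.tmul C x = TensorProduct.dualDistribEquiv F V W
      (TensorProduct.congr (B.toDual hB) (C.toDual hC) x) := by
    intro x
    have : (B.tmul C : (V ⊗[F] W) →ₗ[F] Module.Dual F (V ⊗[F] W)) =
        (TensorProduct.dualDistribEquiv F V W).toLinearMap ∘ₗ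
          (TensorProduct.congr (B.toDual hB) (C.toDual hC)).toLinearMap := by
      ext v w v' w'
      simp [TensorProduct.dualDistribEquivOfBasis, LinearMap.BilinForm.toDual_def, mul_comm]
    exact LinearMap.congr_fun this x
  intro x hx
  have h0 : B.tmul C x = 0 := LinearMap.ext hx
  rw [key] at h0
  simpa only [LinearEquiv.map_eq_zero_iff] using h0

/-- For a bilinear form `A` (not necessarily symmetric) representing the quadratic form `q`,
that is `A w w = q w`, the form `B ⊗ q` is `z ↦ (B ⊗ A) (z, z)`. For symmetric `B` it does not
depend on `A`: it is the only quadratic form on `V ⊗ W` with `(B ⊗ q) (v ⊗ w) = B (v, v) q (w)`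
and with polar form `B ⊗ b_q`, see `bilinTensorQuad_tmul`, `polar_bilinTensorQuad` and
`quad_tensor_ext`. -/
def bilinTensorQuad (B : BilinForm F V) (q : QuadraticForm F W) : QuadraticForm F (V ⊗[F] W) :=
  LinearMap.BilinMap.toQuadraticMap
    (B.tmul (LinearMap.BilinMap.toQuadraticMap_surjective q).choose)

theorem bilinTensorQuad_tmul (B : BilinForm F V) (q : QuadraticForm F W) (v : V) (w : W) :
    bilinTensorQuad B q (v ⊗ₜ w) = B v v * q w := by
  have h := (LinearMap.BilinMap.toQuadraticMap_surjective q).choose_spec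
  rw [bilinTensorQuad, LinearMap.BilinMap.toQuadraticMap_apply, tmul_apply]
  conv_rhs => rw [← h]
  rfl

theorem polar_bilinTensorQuad {B : BilinForm F V} (hB : ∀ x y, B x y = B y x)
    (q : QuadraticForm F W) :
    (bilinTensorQuad B q).polarBilin = B.tmul q.polarBilin := by
  have h := (LinearMap.BilinMap.toQuadraticMap_surjective q).choose_spec
  have h2 : q.polarBilin = (LinearMap.BilinMap.toQuadraticMap_surjective q).choose +
      (LinearMap.BilinMap.toQuadraticMap_surjective q).choose.flip := by
    conv_lhs => rw [← h]
    exact LinearMap.BilinMap.polarBilin_toQuadraticMap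
  rw [bilinTensorQuad, LinearMap.BilinMap.polarBilin_toQuadraticMap, h2]
  ext v w v' w'
  simp [hB v' v, add_mul]

theorem quad_tensor_ext {q q' : QuadraticForm F (V ⊗[F] W)}
    (h : ∀ v w, q (v ⊗ₜ w) = q' (v ⊗ₜ w)) (hp : q.polarBilin = q'.polarBilin) : q = q' := by
  ext z
  induction z with
  | zero => simp
  | tmul v w => exact h v w
  | add x y hx hy =>
    have := LinearMap.congr_fun₂ hp x y
    simp only [QuadraticMap.polarBilin_apply_apply, QuadraticMap.polar, hx, hy] at this
    linear_combination this

/-- A nonsingular quadratic form with a totally singular subspace of half the dimension is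
hyperbolic. -/
theorem hyperbolic_of_lagrangian [FiniteDimensional F V] (q : QuadraticForm F V)
    (hq : q.polarBilin.Nondegenerate) (U : Submodule F V) (hU : ∀ x ∈ U, q x = 0)
    (hd : Module.finrank F V = 2 * Module.finrank F U) :
    ∃ n : ℕ, q.Equivalent (QuadraticForm.dualProd F (Fin n → F)) := by
  obtain ⟨C, hC⟩ := U.exists_isCompl
  obtain ⟨A, hA⟩ := LinearMap.BilinMap.toQuadraticMap_surjective (q.restrict C)
  have hb : ∀ x ∈ U, ∀ y ∈ U, q.polarBilin x y = 0 := fun x hx y hy => by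
    simp [QuadraticMap.polar, hU x hx, hU y hy, hU _ (U.add_mem hx hy)]
  -- the map `U → C*` induced by the polar form
  let β : U →ₗ[F] Module.Dual F C :=
    (LinearMap.lcomp F F C.subtype) ∘ₗ q.polarBilin ∘ₗ U.subtype
  have hβ : ∀ (u : U) (c : C), β u c = q.polarBilin u c := fun _ _ => rfl
  have hβi : Function.Injective β := by
    rw [injective_iff_map_eq_zero]
    intro u hu
    have : (u : V) = 0 := by
      refine hq.1 _ fun y => ?_
      obtain ⟨a, ha, c, hc, rfl⟩ := Submodule.mem_sup.1 (hC.sup_eq_top ▸ Submodule.mem_top : y ∈ U ⊔ C)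
      rw [map_add, hb _ u.2 _ ha, zero_add]
      exact LinearMap.congr_fun hu ⟨c, hc⟩
    exact_mod_cast this
  have hfr : Module.finrank F U = Module.finrank F (Module.Dual F C) := by
    have := Submodule.finrank_add_eq_of_isCompl hC
    rw [Subspace.dual_finrank_eq]; omega
  let βe : U ≃ₗ[F] Module.Dual F C := LinearEquiv.ofInjectiveOfFinrankEq β hβi hfr
  let γ : (U × C) ≃ₗ[F] (Module.Dual F C × C) :=
    LinearEquiv.ofBijective
      ((β.coprod A).prod (LinearMap.snd F U C)) (by
        constructor
        · rw [injective_iff_map_eq_zero]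
          rintro ⟨u, c⟩ h
          obtain ⟨h1, h2⟩ := Prod.mk_inj.1 h
          simp only [LinearMap.snd_apply] at h2
          subst h2
          simp only [LinearMap.coprod_apply, map_zero, add_zero] at h1
          rw [hβi (h1.trans (map_zero β).symm)]; rfl
        · rintro ⟨f, c⟩
          obtain ⟨u, hu⟩ := βe.surjective (f - A c)
          have hu' : β u = f - A c := hu
          exact ⟨(u, c), by simp [hu']⟩)
  have hγ : ∀ u c, γ (u, c) = (β u + A c, c) := fun _ _ => rfl
  let e := (Submodule.prodEquivOfIsCompl U C hC).symm ≪≫ₗ γ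
  refine ⟨Module.finrank F C, ?_⟩
  refine QuadraticMap.Equivalent.trans (Q₂ := QuadraticForm.dualProd F C) ⟨⟨e, ?_⟩⟩
    ⟨QuadraticForm.dualProdIsometry (Module.finBasis F C).equivFun⟩
  intro m
  obtain ⟨⟨u, c⟩, rfl⟩ := (Submodule.prodEquivOfIsCompl U C hC).surjective m
  have hAc : A c c = q c := by
    have := QuadraticMap.congr_fun hA c
    simpa using this
  have : e (Submodule.prodEquivOfIsCompl U C hC (u, c)) = γ (u, c) := by simp [e]
  change QuadraticForm.dualProd F C (e _) = _
  rw [this, hγ]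
  simp only [QuadraticForm.dualProd_apply, LinearMap.add_apply, hβ, hAc,
    Submodule.coe_prodEquivOfIsCompl']
  simp [QuadraticMap.polar, hU _ u.2]

theorem dualProd_polar_nondegenerate [FiniteDimensional F V] :
    (QuadraticForm.dualProd F V).polarBilin.Nondegenerate := by
  have hp : ∀ x y : Module.Dual F V × V,
      (QuadraticForm.dualProd F V).polarBilin x y = x.1 y.2 + y.1 x.2 := fun x y => by
    simp [QuadraticMap.polar]
    ring
  refine nondeg_of_symm (fun x y => by rw [hp, hp, add_comm]) fun x hx => ?_
  refine Prod.ext (LinearMap.ext fun v => ?_) ?_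
  · simpa [hp] using hx (0, v)
  · refine (Module.forall_dual_apply_eq_zero_iff F x.2).1 fun f => ?_
    simpa [hp] using hx (f, 0)

end Forms

/-! ### The Witt ring of nondegenerate symmetric bilinear forms -/

section BilinIsometries

variable {F : Type*} [Field F]
variable {V : Type*} [AddCommGroup V] [Module F V]
variable {W : Type*} [AddCommGroup W] [Module F W]
variable {V' : Type*} [AddCommGroup V'] [Module F V']
variable {W' : Type*} [AddCommGroup W'] [Module F W']

theorem bilinSum_congr {B : BilinForm F V} {B' : BilinForm F V'} {C : BilinForm F W}
    {C' : BilinForm F W'} (h : B.Equivalent B') (k : C.Equivalent C') :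
    (bilinSum B C).Equivalent (bilinSum B' C') := by
  obtain ⟨e⟩ := h
  obtain ⟨f⟩ := k
  exact ⟨⟨e.toLinearEquiv.prodCongr f.toLinearEquiv, fun x y =>
    congr_arg₂ (· + ·) (e.map_app' x.1 y.1) (f.map_app' x.2 y.2)⟩⟩

theorem bilinSum_comm (B : BilinForm F V) (C : BilinForm F W) :
    (bilinSum B C).Equivalent (bilinSum C B) :=
  ⟨⟨LinearEquiv.prodComm F V W, fun _ _ => add_comm _ _⟩⟩

theorem bilinSum_assoc (B : BilinForm F V) (C : BilinForm F W) (D : BilinForm F V') :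
    (bilinSum (bilinSum B C) D).Equivalent (bilinSum B (bilinSum C D)) :=
  ⟨⟨LinearEquiv.prodAssoc F V W V', fun _ _ => (add_assoc _ _ _).symm⟩⟩

theorem bilinSum_right_comm (B : BilinForm F V) (C : BilinForm F W) (D : BilinForm F V') :
    (bilinSum (bilinSum B C) D).Equivalent (bilinSum (bilinSum B D) C) :=
  (bilinSum_assoc B C D).trans
    ((bilinSum_congr (.refl B) (bilinSum_comm C D)).trans (bilinSum_assoc B D C).symm)

theorem bilinTensor_congr {B : BilinForm F V} {B' : BilinForm F V'} {C : BilinForm F W}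
    {C' : BilinForm F W'} (h : B.Equivalent B') (k : C.Equivalent C') :
    LinearMap.BilinForm.Equivalent (B.tmul C) (B'.tmul C') := by
  obtain ⟨e⟩ := h
  obtain ⟨f⟩ := k
  refine ⟨⟨TensorProduct.congr e.toLinearEquiv f.toLinearEquiv, fun x y => ?_⟩⟩
  have : (B'.tmul C').compl₁₂
      (TensorProduct.congr e.toLinearEquiv f.toLinearEquiv).toLinearMap
      (TensorProduct.congr e.toLinearEquiv f.toLinearEquiv).toLinearMap = B.tmul C := by
    ext v w v' w'
    exact congr_arg₂ (· * ·) (f.map_app' w w') (e.map_app' v v')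
  exact LinearMap.congr_fun₂ this x y

theorem bilinTensor_comm (B : BilinForm F V) (C : BilinForm F W) :
    LinearMap.BilinForm.Equivalent (B.tmul C) (C.tmul B) := by
  refine ⟨⟨TensorProduct.comm F V W, fun x y => ?_⟩⟩
  have : (C.tmul B).compl₁₂ (TensorProduct.comm F V W).toLinearMap
      (TensorProduct.comm F V W).toLinearMap = B.tmul C := by
    ext v w v' w'
    exact mul_comm _ _
  exact LinearMap.congr_fun₂ this x y

theorem bilinTensor_assoc (B : BilinForm F V) (C : BilinForm F W) (D : BilinForm F V') :
    LinearMap.BilinForm.Equivalent (BilinForm.tmul (B.tmul C) D) (B.tmul (C.tmul D)) := by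
  refine ⟨⟨TensorProduct.assoc F V W V', fun x y => ?_⟩⟩
  have : (B.tmul (C.tmul D)).compl₁₂ (TensorProduct.assoc F V W V').toLinearMap
      (TensorProduct.assoc F V W V').toLinearMap = BilinForm.tmul (B.tmul C) D := by
    ext v w x v' w' x'
    simp [mul_assoc]
  exact LinearMap.congr_fun₂ this x y

theorem bilinTensor_one (B : BilinForm F V) :
    LinearMap.BilinForm.Equivalent (BilinForm.tmul (LinearMap.mul F F) B) B := by
  refine ⟨⟨TensorProduct.lid F V, fun x y => ?_⟩⟩
  have : B.compl₁₂ (TensorProduct.lid F V).toLinearMap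
      (TensorProduct.lid F V).toLinearMap = BilinForm.tmul (LinearMap.mul F F) B := by
    ext v v'
    simp
  exact LinearMap.congr_fun₂ this x y

theorem bilinTensor_sum (B : BilinForm F V) (C : BilinForm F W) (D : BilinForm F W') :
    LinearMap.BilinForm.Equivalent (B.tmul (bilinSum C D))
      (bilinSum (B.tmul C) (B.tmul D)) := by
  refine ⟨⟨TensorProduct.prodRight F F V W W', fun x y => ?_⟩⟩
  have : (bilinSum (B.tmul C) (B.tmul D)).compl₁₂
      (TensorProduct.prodRight F F V W W').toLinearMap
      (TensorProduct.prodRight F F V W W').toLinearMap = B.tmul (bilinSum C D) := by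
    ext v w v' w' <;> simp
  exact LinearMap.congr_fun₂ this x y

/-- A bilinear form is metabolic if it has a Lagrangian: a totally isotropic subspace of half
the dimension of the whole space. -/
def IsMetabolic (B : BilinForm F V) : Prop :=
  ∃ U : Submodule F V, (∀ x ∈ U, ∀ y ∈ U, B x y = 0) ∧
    Module.finrank F V = 2 * Module.finrank F U

theorem finrank_submodule_prod [FiniteDimensional F V] [FiniteDimensional F W]
    (U : Submodule F V) (U' : Submodule F W) :
    Module.finrank F (U.prod U') = Module.finrank F U + Module.finrank F U' := by
  have h : U.prod U' = LinearMap.range (U.subtype.prodMap U'.subtype) := by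
    rw [LinearMap.range_prodMap, Submodule.range_subtype, Submodule.range_subtype]
  rw [h, LinearMap.finrank_range_of_inj, Module.finrank_prod]
  exact U.injective_subtype.prodMap U'.injective_subtype

theorem IsMetabolic.sum [FiniteDimensional F V] [FiniteDimensional F W]
    {B : BilinForm F V} {C : BilinForm F W}
    (hB : IsMetabolic B) (hC : IsMetabolic C) : IsMetabolic (bilinSum B C) := by
  obtain ⟨U, hU, hd⟩ := hB
  obtain ⟨U', hU', hd'⟩ := hC
  refine ⟨U.prod U', fun x hx y hy => ?_, ?_⟩
  · rw [bilinSum_apply, hU _ hx.1 _ hy.1, hU' _ hx.2 _ hy.2, add_zero]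
  · rw [Module.finrank_prod, finrank_submodule_prod]; omega

theorem finrank_range_lTensor (U : Submodule F V) :
    Module.finrank F (LinearMap.range (TensorProduct.map U.subtype (LinearMap.id : W →ₗ[F] W))) =
      Module.finrank F U * Module.finrank F W := by
  rw [LinearMap.finrank_range_of_inj, Module.finrank_tensorProduct]
  exact Module.Flat.rTensor_preserves_injective_linearMap (M := W) U.subtype U.injective_subtype

theorem IsMetabolic.tensor {B : BilinForm F V} (hB : IsMetabolic B) (C : BilinForm F W) :
    IsMetabolic (B.tmul C : BilinForm F (V ⊗[F] W)) := by
  obtain ⟨U, hU, hd⟩ := hB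
  refine ⟨LinearMap.range (TensorProduct.map U.subtype (LinearMap.id : W →ₗ[F] W)), ?_, ?_⟩
  · rintro _ ⟨x, rfl⟩ _ ⟨y, rfl⟩
    have : (B.tmul C).compl₁₂ (TensorProduct.map U.subtype (LinearMap.id : W →ₗ[F] W))
        (TensorProduct.map U.subtype (LinearMap.id : W →ₗ[F] W)) = 0 := by
      ext v w v' w'
      simp [hU _ v.2 _ v'.2]
    exact LinearMap.congr_fun₂ this x y
  · rw [finrank_range_lTensor, Module.finrank_tensorProduct, hd, mul_assoc]

theorem IsMetabolic.neg_self (B : BilinForm F V) [FiniteDimensional F V] :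
    IsMetabolic (bilinSum (-B) B) := by
  refine ⟨LinearMap.range ((LinearMap.id : V →ₗ[F] V).prod LinearMap.id), ?_, ?_⟩
  · rintro _ ⟨x, rfl⟩ _ ⟨y, rfl⟩
    simp
  · rw [LinearMap.finrank_range_of_inj, Module.finrank_prod, two_mul]
    exact fun x y h => congr_arg Prod.fst h

end BilinIsometries

/-- A finite-dimensional space with a nondegenerate symmetric bilinear form. -/
structure BilinSpace (F : Type u) [Field F] : Type (u + 1) where
  carrier : Type u
  [addCommGroup : AddCommGroup carrier]
  [module : Module F carrier]
  [finite : FiniteDimensional F carrier]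
  form : BilinForm F carrier
  symm : ∀ x y, form x y = form y x
  nondegenerate : form.Nondegenerate

attribute [instance] BilinSpace.addCommGroup BilinSpace.module BilinSpace.finite

namespace BilinSpace

variable {F : Type u} [Field F]

/-- Orthogonal sum. -/
def sum (X Y : BilinSpace F) : BilinSpace F where
  carrier := X.carrier × Y.carrier
  form := bilinSum X.form Y.form
  symm x y := by simp [X.symm x.1, Y.symm x.2]
  nondegenerate := bilinSum_nondegenerate X.nondegenerate Y.nondegenerate

/-- Tensor product. -/
def tensor (X Y : BilinSpace F) : BilinSpace F where
  carrier := X.carrier ⊗[F] Y.carrier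
  form := X.form.tmul Y.form
  symm := (LinearMap.IsSymm.tmul ⟨X.symm⟩ ⟨Y.symm⟩).eq
  nondegenerate := nondeg_of_symm (LinearMap.IsSymm.tmul ⟨X.symm⟩ ⟨Y.symm⟩).eq
    (tmul_separatingLeft X.nondegenerate Y.nondegenerate)

/-- The space with the opposite form. -/
def neg (X : BilinSpace F) : BilinSpace F where
  carrier := X.carrier
  form := -X.form
  symm x y := by simp [X.symm x]
  nondegenerate := nondeg_of_symm (fun x y => by simp [X.symm x])
    fun x hx => X.nondegenerate.1 x fun y => by simpa using hx y

variable (F) in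
/-- The zero space. -/
def zero : BilinSpace F where
  carrier := PUnit
  form := 0
  symm _ _ := rfl
  nondegenerate := nondeg_of_symm (fun _ _ => rfl) fun _ _ => rfl

variable (F) in
/-- The form `⟨1⟩`. -/
def one : BilinSpace F where
  carrier := F
  form := LinearMap.mul F F
  symm := mul_comm
  nondegenerate := nondeg_of_symm mul_comm fun x hx => by simpa using hx 1

/-- Witt equivalence: isometry after adding metabolic forms. -/
def WittEquiv (X Y : BilinSpace F) : Prop :=
  ∃ M N : BilinSpace F, IsMetabolic M.form ∧ IsMetabolic N.form ∧
    (X.sum M).form.Equivalent (Y.sum N).form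

theorem zero_metabolic : IsMetabolic (zero F).form :=
  ⟨⊥, fun _ _ _ _ => rfl, by
    change Module.finrank F PUnit.{u + 1} = _
    rw [Module.finrank_zero_of_subsingleton, finrank_bot]⟩

theorem WittEquiv.of_isometry {X Y : BilinSpace F} (h : X.form.Equivalent Y.form) :
    WittEquiv X Y :=
  ⟨zero F, zero F, zero_metabolic, zero_metabolic, bilinSum_congr h (.refl _)⟩

theorem WittEquiv.symm {X Y : BilinSpace F} (h : WittEquiv X Y) : WittEquiv Y X := by
  obtain ⟨M, N, hM, hN, e⟩ := h
  exact ⟨N, M, hN, hM, e.symm⟩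

theorem WittEquiv.trans {X Y Z : BilinSpace F} (h : WittEquiv X Y) (k : WittEquiv Y Z) :
    WittEquiv X Z := by
  obtain ⟨M, N, hM, hN, e⟩ := h
  obtain ⟨K, L, hK, hL, f⟩ := k
  refine ⟨M.sum K, L.sum N, hM.sum hK, hL.sum hN, ?_⟩
  exact (bilinSum_assoc _ _ _).symm.trans <| (bilinSum_congr e (.refl _)).trans <|
    (bilinSum_right_comm _ _ _).trans <| (bilinSum_congr f (.refl _)).trans <|
    bilinSum_assoc _ _ _

theorem WittEquiv.of_metabolic {X : BilinSpace F} (h : IsMetabolic X.form) :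
    WittEquiv X (zero F) :=
  ⟨zero F, X, zero_metabolic, h, bilinSum_comm _ _⟩

theorem WittEquiv.sum_left {X X' : BilinSpace F} (h : WittEquiv X X') (Y : BilinSpace F) :
    WittEquiv (X.sum Y) (X'.sum Y) := by
  obtain ⟨M, N, hM, hN, e⟩ := h
  exact ⟨M, N, hM, hN, (bilinSum_right_comm _ _ _).trans <|
    (bilinSum_congr e (.refl _)).trans (bilinSum_right_comm _ _ _)⟩

theorem WittEquiv.sum_comm (X Y : BilinSpace F) : WittEquiv (X.sum Y) (Y.sum X) :=
  .of_isometry (bilinSum_comm _ _)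

theorem WittEquiv.sum {X X' Y Y' : BilinSpace F} (h : WittEquiv X X') (k : WittEquiv Y Y') :
    WittEquiv (X.sum Y) (X'.sum Y') :=
  (h.sum_left Y).trans <| (WittEquiv.sum_comm _ _).trans <|
    (k.sum_left X').trans (WittEquiv.sum_comm _ _)

theorem WittEquiv.tensor_comm (X Y : BilinSpace F) : WittEquiv (X.tensor Y) (Y.tensor X) :=
  .of_isometry (bilinTensor_comm _ _)

theorem WittEquiv.tensor_right (X : BilinSpace F) {Y Y' : BilinSpace F} (h : WittEquiv Y Y') :
    WittEquiv (X.tensor Y) (X.tensor Y') := by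
  obtain ⟨M, N, hM, hN, e⟩ := h
  have key : ∀ Z K : BilinSpace F, LinearMap.BilinForm.Equivalent
      (X.tensor (Z.sum K)).form ((X.tensor Z).sum (K.tensor X)).form := fun Z K =>
    (bilinTensor_sum _ _ _).trans (bilinSum_congr (.refl _) (bilinTensor_comm _ _))
  exact ⟨M.tensor X, N.tensor X, hM.tensor _, hN.tensor _,
    (key Y M).symm.trans ((bilinTensor_congr (.refl _) e).trans (key Y' N))⟩

theorem WittEquiv.tensor {X X' Y Y' : BilinSpace F} (h : WittEquiv X X') (k : WittEquiv Y Y') :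
    WittEquiv (X.tensor Y) (X'.tensor Y') :=
  (k.tensor_right X).trans <| (WittEquiv.tensor_comm _ _).trans <|
    (h.tensor_right Y').trans (WittEquiv.tensor_comm _ _)

theorem WittEquiv.neg {X Y : BilinSpace F} (h : WittEquiv X Y) : WittEquiv X.neg Y.neg := by
  obtain ⟨M, N, ⟨U, hU, hd⟩, ⟨U', hU', hd'⟩, ⟨e⟩⟩ := h
  refine ⟨M.neg, N.neg, ⟨U, fun x hx y hy => ?_, hd⟩, ⟨U', fun x hx y hy => ?_, hd'⟩,
    ⟨e.toLinearEquiv, fun x y => ?_⟩⟩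
  · exact neg_eq_zero.2 (hU x hx y hy)
  · exact neg_eq_zero.2 (hU' x hx y hy)
  · exact (neg_add _ _).symm.trans ((congr_arg Neg.neg (e.map_app' x y)).trans (neg_add _ _))

variable (F) in
/-- Witt equivalence as a setoid. -/
def setoid : Setoid (BilinSpace F) :=
  ⟨WittEquiv, fun _ => .of_isometry (.refl _), .symm, .trans⟩

end BilinSpace

/-- The Witt ring `W(F)` of nondegenerate symmetric bilinear forms. -/
def WittRing (F : Type u) [Field F] : Type (u + 1) := Quotient (BilinSpace.setoid F)

namespace WittRing

variable {F : Type u} [Field F]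

/-- The Witt class of a nondegenerate symmetric bilinear form. -/
def mk (X : BilinSpace F) : WittRing F := Quotient.mk (BilinSpace.setoid F) X

theorem mk_eq {X Y : BilinSpace F} : mk X = mk Y ↔ X.WittEquiv Y :=
  Quotient.eq (r := BilinSpace.setoid F)

theorem mk_eq_of_isometry {X Y : BilinSpace F} (h : X.form.Equivalent Y.form) : mk X = mk Y :=
  mk_eq.2 (.of_isometry h)

theorem ind {P : WittRing F → Prop} (h : ∀ X, P (mk X)) (w : WittRing F) : P w :=
  Quotient.inductionOn w h

instance : Zero (WittRing F) := ⟨mk (.zero F)⟩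
instance : One (WittRing F) := ⟨mk (.one F)⟩
instance : Add (WittRing F) :=
  ⟨Quotient.map₂ BilinSpace.sum fun _ _ h _ _ k => BilinSpace.WittEquiv.sum h k⟩
instance : Mul (WittRing F) :=
  ⟨Quotient.map₂ BilinSpace.tensor fun _ _ h _ _ k => BilinSpace.WittEquiv.tensor h k⟩
instance : Neg (WittRing F) :=
  ⟨Quotient.map BilinSpace.neg fun _ _ h => BilinSpace.WittEquiv.neg h⟩

theorem zero_def : (0 : WittRing F) = mk (.zero F) := rfl
theorem one_def : (1 : WittRing F) = mk (.one F) := rfl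
theorem mk_add (X Y : BilinSpace F) : mk X + mk Y = mk (X.sum Y) := rfl
theorem mk_mul (X Y : BilinSpace F) : mk X * mk Y = mk (X.tensor Y) := rfl
theorem mk_neg (X : BilinSpace F) : -mk X = mk X.neg := rfl

protected theorem add_comm' (a b : WittRing F) : a + b = b + a := by
  induction a using ind with | _ X
  induction b using ind with | _ Y
  exact mk_eq_of_isometry (bilinSum_comm _ _)

protected theorem zero_add' (a : WittRing F) : 0 + a = a := by
  induction a using ind with | _ X
  refine mk_eq_of_isometry ⟨⟨LinearEquiv.uniqueProd (M₂ := PUnit.{u + 1}), fun x y => ?_⟩⟩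
  exact (zero_add _).symm

protected theorem mul_comm' (a b : WittRing F) : a * b = b * a := by
  induction a using ind with | _ X
  induction b using ind with | _ Y
  exact mk_eq_of_isometry (bilinTensor_comm _ _)

protected theorem one_mul' (a : WittRing F) : 1 * a = a := by
  induction a using ind with | _ X
  exact mk_eq_of_isometry (bilinTensor_one _)

protected theorem mul_add' (a b c : WittRing F) : a * (b + c) = a * b + a * c := by
  induction a using ind with | _ X
  induction b using ind with | _ Y
  induction c using ind with | _ Z
  exact mk_eq_of_isometry (bilinTensor_sum _ _ _)

protected theorem zero_mul' (a : WittRing F) : 0 * a = 0 := by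
  induction a using ind with | _ X
  exact mk_eq.2 (.of_metabolic (BilinSpace.zero_metabolic.tensor _))

instance : CommRing (WittRing F) where
  add_assoc a b c := by
    induction a using ind with | _ X
    induction b using ind with | _ Y
    induction c using ind with | _ Z
    exact mk_eq_of_isometry (bilinSum_assoc _ _ _)
  zero_add := WittRing.zero_add'
  add_zero a := by rw [WittRing.add_comm', WittRing.zero_add']
  add_comm := WittRing.add_comm'
  nsmul := nsmulRec
  zsmul := zsmulRec
  neg_add_cancel a := by
    induction a using ind with | _ X
    exact mk_eq.2 (.of_metabolic (.neg_self _))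
  mul_assoc a b c := by
    induction a using ind with | _ X
    induction b using ind with | _ Y
    induction c using ind with | _ Z
    exact mk_eq_of_isometry (bilinTensor_assoc _ _ _)
  one_mul := WittRing.one_mul'
  mul_one a := by rw [WittRing.mul_comm', WittRing.one_mul']
  mul_comm := WittRing.mul_comm'
  left_distrib := WittRing.mul_add'
  right_distrib a b c := by
    rw [WittRing.mul_comm', WittRing.mul_add', WittRing.mul_comm' c, WittRing.mul_comm' c]
  zero_mul := WittRing.zero_mul'
  mul_zero a := by rw [WittRing.mul_comm', WittRing.zero_mul']

theorem dim_mod_two_eq {X Y : BilinSpace F} (h : X.WittEquiv Y) :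
    (Module.finrank F X.carrier : ZMod 2) = (Module.finrank F Y.carrier : ZMod 2) := by
  obtain ⟨M, N, ⟨U, _, hd⟩, ⟨U', _, hd'⟩, ⟨e⟩⟩ := h
  have h1 : Module.finrank F (X.carrier × M.carrier) = Module.finrank F (Y.carrier × N.carrier) :=
    e.toLinearEquiv.finrank_eq
  rw [Module.finrank_prod, Module.finrank_prod, hd, hd'] at h1
  rw [ZMod.natCast_eq_natCast_iff']
  omega

variable (F) in
/-- The dimension index `W(F) → ℤ/2`, sending the class of a form to its dimension modulo `2`. -/
def dimIndex : WittRing F →+* ZMod 2 where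
  toFun := Quotient.lift (fun X : BilinSpace F => (Module.finrank F X.carrier : ZMod 2))
    fun _ _ h => dim_mod_two_eq h
  map_one' := by
    change (Module.finrank F F : ZMod 2) = 1
    simp
  map_zero' := by
    change (Module.finrank F PUnit.{u + 1} : ZMod 2) = 0
    rw [Module.finrank_zero_of_subsingleton, Nat.cast_zero]
  map_add' a b := by
    induction a using ind with | _ X
    induction b using ind with | _ Y
    change (Module.finrank F (X.carrier × Y.carrier) : ZMod 2) =
      Module.finrank F X.carrier + Module.finrank F Y.carrier
    simp
  map_mul' a b := by
    induction a using ind with | _ X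
    induction b using ind with | _ Y
    change (Module.finrank F (X.carrier ⊗[F] Y.carrier) : ZMod 2) =
      Module.finrank F X.carrier * Module.finrank F Y.carrier
    simp

theorem dimIndex_mk (X : BilinSpace F) : dimIndex F (mk X) = Module.finrank F X.carrier := rfl

variable (F) in
/-- The fundamental ideal `I(F)`: the classes of even-dimensional forms. -/
def fundamentalIdeal : Ideal (WittRing F) := RingHom.ker (dimIndex F)

end WittRing

/-! ### The Witt group of nonsingular quadratic forms -/

section QuadIsometries

variable {F : Type*} [Field F]
variable {V : Type*} [AddCommGroup V] [Module F V]
variable {W : Type*} [AddCommGroup W] [Module F W]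
variable {V' : Type*} [AddCommGroup V'] [Module F V']
variable {W' : Type*} [AddCommGroup W'] [Module F W']

theorem quadProd_comm (p : QuadraticForm F V) (q : QuadraticForm F W) :
    QuadraticMap.Equivalent (p.prod q) (q.prod p) :=
  ⟨QuadraticMap.IsometryEquiv.prodComm p q⟩

theorem quadProd_assoc (p : QuadraticForm F V) (q : QuadraticForm F W)
    (r : QuadraticForm F V') :
    QuadraticMap.Equivalent ((p.prod q).prod r) (p.prod (q.prod r)) :=
  ⟨⟨LinearEquiv.prodAssoc F V W V', fun _ => (add_assoc _ _ _).symm⟩⟩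

theorem quadProd_right_comm (p : QuadraticForm F V) (q : QuadraticForm F W)
    (r : QuadraticForm F V') :
    QuadraticMap.Equivalent ((p.prod q).prod r) ((p.prod r).prod q) :=
  (quadProd_assoc p q r).trans <|
    (QuadraticMap.Equivalent.prod (.refl p) (quadProd_comm q r)).trans (quadProd_assoc p r q).symm

theorem polarBilin_quadProd (p : QuadraticForm F V) (q : QuadraticForm F W) :
    QuadraticMap.polarBilin (p.prod q) = bilinSum p.polarBilin q.polarBilin := by
  refine LinearMap.ext₂ fun x y => ?_
  simp

theorem polarBilin_symm (q : QuadraticForm F V) (x y : V) :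
    q.polarBilin x y = q.polarBilin y x := by
  simp [QuadraticMap.polar_comm q x y]

theorem equivalent_of_tensor {B : BilinForm F V} (hB : ∀ x y, B x y = B y x)
    {q : QuadraticForm F W} {r : QuadraticForm F V'} (e : (V ⊗[F] W) ≃ₗ[F] V')
    (h1 : ∀ v w, r (e (v ⊗ₜ w)) = B v v * q w)
    (h2 : ∀ v w v' w', r.polarBilin (e (v ⊗ₜ w)) (e (v' ⊗ₜ w')) = B v v' * q.polarBilin w w') :
    (bilinTensorQuad B q).Equivalent r := by
  have : r.comp e.toLinearMap = bilinTensorQuad B q := by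
    refine quad_tensor_ext (fun v w => ?_) ?_
    · rw [bilinTensorQuad_tmul]; exact h1 v w
    · rw [polar_bilinTensorQuad hB, QuadraticMap.polarBilin_comp]
      ext v w v' w'
      have := h2 v w v' w'
      simp only [QuadraticMap.polarBilin_apply_apply] at this
      simp [this, mul_comm]
  exact ⟨⟨e, fun x => QuadraticMap.congr_fun this x⟩⟩

theorem polar_eq_of_isometry {q : QuadraticForm F V} {q' : QuadraticForm F V'}
    (e : q.IsometryEquiv q') (x y : V) : q'.polarBilin (e x) (e y) = q.polarBilin x y := by
  simp [QuadraticMap.polar, ← map_add]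

theorem polar_tensor_apply {B : BilinForm F V} (hB : ∀ x y, B x y = B y x)
    (q : QuadraticForm F W) (v v' : V) (w w' : W) :
    (bilinTensorQuad B q).polarBilin (v ⊗ₜ w) (v' ⊗ₜ w') = B v v' * q.polarBilin w w' := by
  rw [polar_bilinTensorQuad hB, tmul_apply]

theorem bilinTensorQuad_congr {B : BilinForm F V} {B' : BilinForm F V'}
    (hB : ∀ x y, B x y = B y x) (hB' : ∀ x y, B' x y = B' y x)
    {q : QuadraticForm F W} {q' : QuadraticForm F W'} (h : B.Equivalent B')
    (k : q.Equivalent q') :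
    (bilinTensorQuad B q).Equivalent (bilinTensorQuad B' q') := by
  obtain ⟨e⟩ := h
  obtain ⟨f⟩ := k
  refine equivalent_of_tensor hB (TensorProduct.congr e.toLinearEquiv f.toLinearEquiv) ?_ ?_
  · intro v w
    rw [TensorProduct.congr_tmul, bilinTensorQuad_tmul]
    exact congr_arg₂ (· * ·) (e.map_app' v v) (f.map_app' w)
  · intro v w v' w'
    rw [TensorProduct.congr_tmul, TensorProduct.congr_tmul, polar_tensor_apply hB']
    exact congr_arg₂ (· * ·) (e.map_app' v v') (polar_eq_of_isometry f w w')

theorem bilinTensorQuad_one (q : QuadraticForm F W) :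
    (bilinTensorQuad (LinearMap.mul F F) q).Equivalent q := by
  refine equivalent_of_tensor (fun x y => mul_comm x y) (TensorProduct.lid F W) ?_ ?_
  · intro v w
    rw [TensorProduct.lid_tmul, QuadraticMap.map_smul]
    rfl
  · intro v w v' w'
    simp [mul_assoc, mul_left_comm]

theorem bilinTensorQuad_assoc {B : BilinForm F V} {C : BilinForm F V'}
    (hB : ∀ x y, B x y = B y x) (hC : ∀ x y, C x y = C y x) (q : QuadraticForm F W) :
    (bilinTensorQuad (B.tmul C) q).Equivalent (bilinTensorQuad B (bilinTensorQuad C q)) := by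
  let e := TensorProduct.assoc F V V' W
  have : (bilinTensorQuad B (bilinTensorQuad C q)).comp e.toLinearMap =
      bilinTensorQuad (B.tmul C) q := by
    have hp : ((bilinTensorQuad B (bilinTensorQuad C q)).comp e.toLinearMap).polarBilin =
        (bilinTensorQuad (B.tmul C) q).polarBilin := by
      rw [polar_bilinTensorQuad (LinearMap.IsSymm.tmul ⟨hB⟩ ⟨hC⟩).eq,
        QuadraticMap.polarBilin_comp, polar_bilinTensorQuad hB, polar_bilinTensorQuad hC]
      ext v v' w x x' y
      simp [e, mul_assoc]
    refine quad_tensor_ext (fun z w => ?_) hp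
    induction z with
    | zero => simp
    | tmul v v' =>
      simp [e, bilinTensorQuad_tmul, mul_comm, mul_left_comm]
    | add x y hx hy =>
      have h := LinearMap.congr_fun₂ hp (x ⊗ₜ w) (y ⊗ₜ w)
      simp only [QuadraticMap.polarBilin_apply_apply, QuadraticMap.polar, hx, hy] at h
      rw [TensorProduct.add_tmul]
      linear_combination h
  exact ⟨⟨e, fun x => QuadraticMap.congr_fun this x⟩⟩

theorem bilinTensorQuad_prod {B : BilinForm F V} (hB : ∀ x y, B x y = B y x)
    (q : QuadraticForm F W) (r : QuadraticForm F W') :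
    (bilinTensorQuad B (q.prod r)).Equivalent
      ((bilinTensorQuad B q).prod (bilinTensorQuad B r)) := by
  refine equivalent_of_tensor hB (TensorProduct.prodRight F F V W W') ?_ ?_
  · rintro v ⟨w, w'⟩
    simp [bilinTensorQuad_tmul, mul_add]
  · rintro v ⟨w, w'⟩ v' ⟨x, x'⟩
    rw [polarBilin_quadProd, polarBilin_quadProd, bilinSum_apply, bilinSum_apply,
      TensorProduct.prodRight_tmul, TensorProduct.prodRight_tmul, polar_tensor_apply hB,
      polar_tensor_apply hB, mul_add]

theorem bilinSum_tensorQuad {B : BilinForm F V} {C : BilinForm F V'}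
    (hB : ∀ x y, B x y = B y x) (hC : ∀ x y, C x y = C y x) (q : QuadraticForm F W) :
    (bilinTensorQuad (bilinSum B C) q).Equivalent
      ((bilinTensorQuad B q).prod (bilinTensorQuad C q)) := by
  refine equivalent_of_tensor (fun x y => by simp [hB x.1, hC x.2])
    (TensorProduct.prodLeft F F V V' W) ?_ ?_
  · rintro ⟨v, v'⟩ w
    simp [bilinTensorQuad_tmul, add_mul]
  · rintro ⟨v, v'⟩ w ⟨x, x'⟩ y
    rw [polarBilin_quadProd, bilinSum_apply, bilinSum_apply,
      TensorProduct.prodLeft_tmul, TensorProduct.prodLeft_tmul, polar_tensor_apply hB,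
      polar_tensor_apply hC, add_mul]

/-- A quadratic form is hyperbolic if it is isometric to an orthogonal sum of hyperbolic planes,
that is to the form `(f, x) ↦ f x` on `(Fⁿ)* × Fⁿ` for some `n`. -/
def IsHyperbolic (q : QuadraticForm F V) : Prop :=
  ∃ n : ℕ, q.Equivalent (QuadraticForm.dualProd F (Fin n → F))

theorem IsHyperbolic.exists_lagrangian {q : QuadraticForm F V} (h : IsHyperbolic q) :
    ∃ U : Submodule F V, (∀ x ∈ U, q x = 0) ∧
      Module.finrank F V = 2 * Module.finrank F U := by
  obtain ⟨n, ⟨e⟩⟩ := h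
  refine ⟨LinearMap.range (e.toLinearEquiv.symm.toLinearMap ∘ₗ
    LinearMap.inl F (Module.Dual F (Fin n → F)) (Fin n → F)), ?_, ?_⟩
  · rintro _ ⟨f, rfl⟩
    have := e.symm.map_app (f, 0)
    exact this.trans (map_zero f)
  · rw [LinearMap.finrank_range_of_inj, e.toLinearEquiv.finrank_eq, Module.finrank_prod,
      Subspace.dual_finrank_eq, two_mul]
    exact e.toLinearEquiv.symm.injective.comp LinearMap.inl_injective

theorem IsHyperbolic.prod {p : QuadraticForm F V} {q : QuadraticForm F W}
    (hp : IsHyperbolic p) (hq : IsHyperbolic q) : IsHyperbolic (p.prod q) := by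
  obtain ⟨m, hm⟩ := hp
  obtain ⟨n, hn⟩ := hq
  refine ⟨m + n, (QuadraticMap.Equivalent.prod hm hn).trans ?_⟩
  refine QuadraticMap.Equivalent.trans ⟨QuadraticForm.dualProdProdIsometry.symm⟩
    ⟨QuadraticForm.dualProdIsometry (LinearEquiv.ofFinrankEq _ _ ?_)⟩
  simp

end QuadIsometries

/-- A finite-dimensional space with a nonsingular quadratic form, that is one whose polar form is
nondegenerate. Over a field of characteristic `2` these are the forms isometric to
`[a₁, b₁] ⊥ ⋯ ⊥ [aᵣ, bᵣ]`, where `[a, b]` is `a X² + X Y + b Y²`. -/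
structure QuadSpace (F : Type u) [Field F] : Type (u + 1) where
  carrier : Type u
  [addCommGroup : AddCommGroup carrier]
  [module : Module F carrier]
  [finite : FiniteDimensional F carrier]
  form : QuadraticForm F carrier
  nonsingular : form.polarBilin.Nondegenerate

attribute [instance] QuadSpace.addCommGroup QuadSpace.module QuadSpace.finite

namespace QuadSpace

variable {F : Type u} [Field F]

theorem isHyperbolic_of_lagrangian (X : QuadSpace F) (U : Submodule F X.carrier)
    (hU : ∀ x ∈ U, X.form x = 0)
    (hd : Module.finrank F X.carrier = 2 * Module.finrank F U) : IsHyperbolic X.form :=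
  hyperbolic_of_lagrangian X.form X.nonsingular U hU hd

/-- Orthogonal sum. -/
def sum (X Y : QuadSpace F) : QuadSpace F where
  carrier := X.carrier × Y.carrier
  form := X.form.prod Y.form
  nonsingular := by
    rw [polarBilin_quadProd]
    exact bilinSum_nondegenerate X.nonsingular Y.nonsingular

/-- The space with the opposite form. -/
def neg (X : QuadSpace F) : QuadSpace F where
  carrier := X.carrier
  form := -X.form
  nonsingular := nondeg_of_symm (polarBilin_symm _) fun x hx => X.nonsingular.1 x fun y => by
    have := hx y
    simpa [QuadraticMap.polar_neg] using this

variable (F) in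
/-- The zero space. -/
def zero : QuadSpace F where
  carrier := PUnit
  form := 0
  nonsingular := nondeg_of_symm (polarBilin_symm _) fun _ _ => rfl

/-- The tensor product of a symmetric bilinear form and a quadratic form. -/
def tensor (B : BilinSpace F) (X : QuadSpace F) : QuadSpace F where
  carrier := B.carrier ⊗[F] X.carrier
  form := bilinTensorQuad B.form X.form
  nonsingular := nondeg_of_symm (polarBilin_symm _) (by
    rw [polar_bilinTensorQuad B.symm]
    exact tmul_separatingLeft B.nondegenerate X.nonsingular)

/-- Witt equivalence: isometry after adding hyperbolic forms. -/
def WittEquiv (X Y : QuadSpace F) : Prop :=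
  ∃ M N : QuadSpace F, IsHyperbolic M.form ∧ IsHyperbolic N.form ∧
    (X.sum M).form.Equivalent (Y.sum N).form

theorem zero_hyperbolic : IsHyperbolic (zero F).form :=
  (zero F).isHyperbolic_of_lagrangian ⊥ (fun _ _ => rfl) (by
    change Module.finrank F PUnit.{u + 1} = _
    rw [Module.finrank_zero_of_subsingleton, finrank_bot])

theorem WittEquiv.of_isometry {X Y : QuadSpace F} (h : X.form.Equivalent Y.form) :
    WittEquiv X Y :=
  ⟨zero F, zero F, zero_hyperbolic, zero_hyperbolic, QuadraticMap.Equivalent.prod h (.refl _)⟩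

theorem WittEquiv.symm {X Y : QuadSpace F} (h : WittEquiv X Y) : WittEquiv Y X := by
  obtain ⟨M, N, hM, hN, e⟩ := h
  exact ⟨N, M, hN, hM, e.symm⟩

theorem WittEquiv.trans {X Y Z : QuadSpace F} (h : WittEquiv X Y) (k : WittEquiv Y Z) :
    WittEquiv X Z := by
  obtain ⟨M, N, hM, hN, e⟩ := h
  obtain ⟨K, L, hK, hL, f⟩ := k
  refine ⟨M.sum K, L.sum N, hM.prod hK, hL.prod hN, ?_⟩
  exact (quadProd_assoc _ _ _).symm.trans <| (QuadraticMap.Equivalent.prod e (.refl _)).trans <|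
    (quadProd_right_comm _ _ _).trans <| (QuadraticMap.Equivalent.prod f (.refl _)).trans <|
    quadProd_assoc _ _ _

theorem WittEquiv.of_hyperbolic {X : QuadSpace F} (h : IsHyperbolic X.form) :
    WittEquiv X (zero F) :=
  ⟨zero F, X, zero_hyperbolic, h, quadProd_comm _ _⟩

theorem WittEquiv.sum_left {X X' : QuadSpace F} (h : WittEquiv X X') (Y : QuadSpace F) :
    WittEquiv (X.sum Y) (X'.sum Y) := by
  obtain ⟨M, N, hM, hN, e⟩ := h
  exact ⟨M, N, hM, hN, (quadProd_right_comm _ _ _).trans <|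
    (QuadraticMap.Equivalent.prod e (.refl _)).trans (quadProd_right_comm _ _ _)⟩

theorem WittEquiv.sum_comm (X Y : QuadSpace F) : WittEquiv (X.sum Y) (Y.sum X) :=
  .of_isometry (quadProd_comm _ _)

theorem WittEquiv.sum {X X' Y Y' : QuadSpace F} (h : WittEquiv X X') (k : WittEquiv Y Y') :
    WittEquiv (X.sum Y) (X'.sum Y') :=
  (h.sum_left Y).trans <| (WittEquiv.sum_comm _ _).trans <|
    (k.sum_left X').trans (WittEquiv.sum_comm _ _)

theorem neg_sum_hyperbolic (X : QuadSpace F) : IsHyperbolic (X.neg.sum X).form := by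
  change IsHyperbolic (QuadraticMap.prod (-X.form) X.form)
  refine hyperbolic_of_lagrangian (QuadraticMap.prod (-X.form) X.form) (X.neg.sum X).nonsingular
    (LinearMap.range ((LinearMap.id : X.carrier →ₗ[F] X.carrier).prod LinearMap.id)) ?_ ?_
  · rintro _ ⟨x, rfl⟩
    exact neg_add_cancel (X.form x)
  · rw [LinearMap.finrank_range_of_inj, Module.finrank_prod, two_mul]
    exact fun x y h => congr_arg Prod.fst h

theorem neg_hyperbolic {X : QuadSpace F} (h : IsHyperbolic X.form) : IsHyperbolic X.neg.form := by
  obtain ⟨U, hU, hd⟩ := h.exists_lagrangian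
  exact X.neg.isHyperbolic_of_lagrangian U (fun x hx => neg_eq_zero.2 (hU x hx)) hd

theorem WittEquiv.neg {X Y : QuadSpace F} (h : WittEquiv X Y) : WittEquiv X.neg Y.neg := by
  obtain ⟨M, N, hM, hN, ⟨e⟩⟩ := h
  refine ⟨M.neg, N.neg, neg_hyperbolic hM, neg_hyperbolic hN, ⟨e.toLinearEquiv, fun x => ?_⟩⟩
  exact (neg_add _ _).symm.trans ((congr_arg Neg.neg (e.map_app' x)).trans (neg_add _ _))

theorem metabolic_tensor_hyperbolic {B : BilinSpace F} (h : IsMetabolic B.form)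
    (X : QuadSpace F) : IsHyperbolic (tensor B X).form := by
  obtain ⟨U, hU, hd⟩ := h
  change IsHyperbolic (bilinTensorQuad B.form X.form)
  refine hyperbolic_of_lagrangian (bilinTensorQuad B.form X.form) (tensor B X).nonsingular
    (LinearMap.range (TensorProduct.map U.subtype (LinearMap.id (M := X.carrier)))) ?_ ?_
  · rintro _ ⟨z, rfl⟩
    have h0 : (bilinTensorQuad B.form X.form).comp
        (TensorProduct.map U.subtype (LinearMap.id (M := X.carrier))) = 0 := by
      refine quad_tensor_ext (fun u w => ?_) ?_
      · simp [bilinTensorQuad_tmul, hU _ u.2 _ u.2]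
      · rw [QuadraticMap.polarBilin_comp, polar_bilinTensorQuad B.symm]
        ext u w u' w'
        simp [hU _ u.2 _ u'.2, QuadraticMap.polar]
    exact QuadraticMap.congr_fun h0 z
  · rw [finrank_range_lTensor, Module.finrank_tensorProduct, hd, mul_assoc]

theorem tensor_hyperbolic (B : BilinSpace F) {X : QuadSpace F} (h : IsHyperbolic X.form) :
    IsHyperbolic (tensor B X).form := by
  obtain ⟨U, hU, hd⟩ := h.exists_lagrangian
  change IsHyperbolic (bilinTensorQuad B.form X.form)
  refine hyperbolic_of_lagrangian (bilinTensorQuad B.form X.form) (tensor B X).nonsingular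
    (LinearMap.range (TensorProduct.map (LinearMap.id (M := B.carrier)) U.subtype)) ?_ ?_
  · rintro _ ⟨z, rfl⟩
    have h0 : (bilinTensorQuad B.form X.form).comp
        (TensorProduct.map (LinearMap.id (M := B.carrier)) U.subtype) = 0 := by
      refine quad_tensor_ext (fun u w => ?_) ?_
      · simp [bilinTensorQuad_tmul, hU _ w.2]
      · rw [QuadraticMap.polarBilin_comp, polar_bilinTensorQuad B.symm]
        ext u w u' w'
        simp [QuadraticMap.polar, hU _ w.2, hU _ w'.2, hU _ (U.add_mem w.2 w'.2)]
    exact QuadraticMap.congr_fun h0 z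
  · rw [LinearMap.finrank_range_of_inj, Module.finrank_tensorProduct,
      Module.finrank_tensorProduct, hd, mul_left_comm]
    exact Module.Flat.lTensor_preserves_injective_linearMap (M := B.carrier) U.subtype
      U.injective_subtype

theorem WittEquiv.tensor {B B' : BilinSpace F} {X X' : QuadSpace F} (h : B.WittEquiv B')
    (k : WittEquiv X X') : WittEquiv (tensor B X) (tensor B' X') := by
  have h1 : WittEquiv (QuadSpace.tensor B X) (QuadSpace.tensor B' X) := by
    obtain ⟨M, N, hM, hN, e⟩ := h
    refine ⟨QuadSpace.tensor M X, QuadSpace.tensor N X, metabolic_tensor_hyperbolic hM X,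
      metabolic_tensor_hyperbolic hN X, ?_⟩
    exact (bilinSum_tensorQuad B.symm M.symm _).symm.trans <|
      (bilinTensorQuad_congr (B.sum M).symm (B'.sum N).symm e (.refl _)).trans
        (bilinSum_tensorQuad B'.symm N.symm _)
  refine h1.trans ?_
  obtain ⟨M, N, hM, hN, e⟩ := k
  refine ⟨QuadSpace.tensor B' M, QuadSpace.tensor B' N, tensor_hyperbolic B' hM,
    tensor_hyperbolic B' hN, ?_⟩
  exact (bilinTensorQuad_prod B'.symm _ _).symm.trans <|
    (bilinTensorQuad_congr B'.symm B'.symm (.refl _) e).trans (bilinTensorQuad_prod B'.symm _ _)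

variable (F) in
/-- Witt equivalence as a setoid. -/
def setoid : Setoid (QuadSpace F) :=
  ⟨WittEquiv, fun _ => .of_isometry (.refl _), .symm, .trans⟩

end QuadSpace

/-- The Witt group `W_q(F)` of nonsingular quadratic forms. -/
def QuadWitt (F : Type u) [Field F] : Type (u + 1) := Quotient (QuadSpace.setoid F)

namespace QuadWitt

variable {F : Type u} [Field F]

/-- The Witt class of a nonsingular quadratic form. -/
def mk (X : QuadSpace F) : QuadWitt F := Quotient.mk (QuadSpace.setoid F) X

theorem mk_eq {X Y : QuadSpace F} : mk X = mk Y ↔ X.WittEquiv Y :=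
  Quotient.eq (r := QuadSpace.setoid F)

theorem mk_eq_of_isometry {X Y : QuadSpace F} (h : X.form.Equivalent Y.form) : mk X = mk Y :=
  mk_eq.2 (.of_isometry h)

theorem ind {P : QuadWitt F → Prop} (h : ∀ X, P (mk X)) (w : QuadWitt F) : P w :=
  Quotient.inductionOn w h

instance : Zero (QuadWitt F) := ⟨mk (.zero F)⟩
instance : Add (QuadWitt F) :=
  ⟨Quotient.map₂ QuadSpace.sum fun _ _ h _ _ k => QuadSpace.WittEquiv.sum h k⟩
instance : Neg (QuadWitt F) :=
  ⟨Quotient.map QuadSpace.neg fun _ _ h => QuadSpace.WittEquiv.neg h⟩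
instance : SMul (WittRing F) (QuadWitt F) :=
  ⟨Quotient.map₂ QuadSpace.tensor fun _ _ h _ _ k => QuadSpace.WittEquiv.tensor h k⟩

theorem zero_def : (0 : QuadWitt F) = mk (.zero F) := rfl
theorem mk_add (X Y : QuadSpace F) : mk X + mk Y = mk (X.sum Y) := rfl
theorem mk_neg (X : QuadSpace F) : -mk X = mk X.neg := rfl
theorem mk_smul (B : BilinSpace F) (X : QuadSpace F) :
    WittRing.mk B • mk X = mk (QuadSpace.tensor B X) := rfl

protected theorem add_comm' (a b : QuadWitt F) : a + b = b + a := by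
  induction a using ind with | _ X
  induction b using ind with | _ Y
  exact mk_eq_of_isometry (quadProd_comm _ _)

protected theorem zero_add' (a : QuadWitt F) : 0 + a = a := by
  induction a using ind with | _ X
  refine mk_eq_of_isometry ⟨⟨LinearEquiv.uniqueProd (M₂ := PUnit.{u + 1}), fun x => ?_⟩⟩
  exact (zero_add _).symm

instance : AddCommGroup (QuadWitt F) where
  add_assoc a b c := by
    induction a using ind with | _ X
    induction b using ind with | _ Y
    induction c using ind with | _ Z
    exact mk_eq_of_isometry (quadProd_assoc _ _ _)
  zero_add := QuadWitt.zero_add'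
  add_zero a := by rw [QuadWitt.add_comm', QuadWitt.zero_add']
  add_comm := QuadWitt.add_comm'
  nsmul := nsmulRec
  zsmul := zsmulRec
  neg_add_cancel a := by
    induction a using ind with | _ X
    exact mk_eq.2 (.of_hyperbolic X.neg_sum_hyperbolic)

/-- The action of the Witt ring on the quadratic Witt group by tensor product. -/
instance : Module (WittRing F) (QuadWitt F) where
  one_smul a := by
    induction a using ind with | _ X
    exact mk_eq_of_isometry (bilinTensorQuad_one _)
  mul_smul b c a := by
    induction a using ind with | _ X
    induction b using WittRing.ind with | _ B
    induction c using WittRing.ind with | _ C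
    exact mk_eq_of_isometry (bilinTensorQuad_assoc B.symm C.symm _)
  smul_zero b := by
    induction b using WittRing.ind with | _ B
    exact mk_eq.2 (.of_hyperbolic (QuadSpace.tensor_hyperbolic B QuadSpace.zero_hyperbolic))
  smul_add b x y := by
    induction b using WittRing.ind with | _ B
    induction x using ind with | _ X
    induction y using ind with | _ Y
    exact mk_eq_of_isometry (bilinTensorQuad_prod B.symm _ _)
  add_smul b c x := by
    induction b using WittRing.ind with | _ B
    induction c using WittRing.ind with | _ C
    induction x using ind with | _ X
    exact mk_eq_of_isometry (bilinSum_tensorQuad B.symm C.symm _)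
  zero_smul x := by
    induction x using ind with | _ X
    exact mk_eq.2
      (.of_hyperbolic (QuadSpace.metabolic_tensor_hyperbolic BilinSpace.zero_metabolic X))

end QuadWitt

/-- `I_q^m(F) = I(F)^(m-1) ⊗ W_q(F)`, for `m ≥ 1`: the submodule of `W_q(F)` generated by the
products of an element of `I(F)^(m-1)` and an element of `W_q(F)`. -/
def Iq (F : Type u) [Field F] (m : ℕ) : Submodule (WittRing F) (QuadWitt F) :=
  (WittRing.fundamentalIdeal F) ^ (m - 1) • (⊤ : Submodule (WittRing F) (QuadWitt F))

/-! ### The transfer -/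

section Transfer

variable {F L : Type u} [Field F] [Field L] [Algebra F L]

section

variable {V : Type*} [AddCommGroup V] [Module L V] [Module F V] [IsScalarTower F L V]

theorem transfer_nonsingular {s : L →ₗ[F] F} (hs : s ≠ 0) {q : QuadraticForm L V}
    (hq : q.polarBilin.Nondegenerate) : (s.compQuadraticMap' q).polarBilin.Nondegenerate := by
  refine nondeg_of_symm (polarBilin_symm _) fun x hx => hq.1 x fun y => ?_
  by_contra hne
  refine hs (LinearMap.ext fun a => ?_)
  have h1 : q.polarBilin x ((a * (q.polarBilin x y)⁻¹) • y) = a := by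
    rw [map_smul, smul_eq_mul, inv_mul_cancel_right₀ hne]
  have h2 : s (q.polarBilin x ((a * (q.polarBilin x y)⁻¹) • y)) = 0 := by
    have h3 : s (q (x + (a * (q.polarBilin x y)⁻¹) • y)) - s (q x) -
        s (q ((a * (q.polarBilin x y)⁻¹) • y)) = 0 := hx ((a * (q.polarBilin x y)⁻¹) • y)
    rw [← map_sub, ← map_sub] at h3
    exact h3
  rw [← h1, h2, LinearMap.zero_apply]

theorem transfer_isHyperbolic [FiniteDimensional F L] [FiniteDimensional L V] {s : L →ₗ[F] F} (hs : s ≠ 0)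
    {q : QuadraticForm L V} (hq : q.polarBilin.Nondegenerate) (h : IsHyperbolic q) :
    IsHyperbolic (s.compQuadraticMap' q) := by
  obtain ⟨U, hU, hd⟩ := h.exists_lagrangian
  have : FiniteDimensional F V := Module.Finite.trans L V
  refine hyperbolic_of_lagrangian _ (transfer_nonsingular hs hq) (U.restrictScalars F) ?_ ?_
  · intro x hx
    simp [hU x hx]
  · have h1 := Module.finrank_mul_finrank F L V
    have h2 := Module.finrank_mul_finrank F L U
    change Module.finrank F V = 2 * Module.finrank F U
    rw [← h1, ← h2, hd, mul_left_comm]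

end

variable [FiniteDimensional F L]

/-- For `s : L → F` linear and nonzero and a nonsingular quadratic form `q` on a space `V` over
`L`, the form `s ∘ q` on `V`, viewed as a space over `F`. -/
def QuadSpace.transfer (s : L →ₗ[F] F) (hs : s ≠ 0) (X : QuadSpace L) : QuadSpace F :=
  letI : Module F X.carrier := Module.restrictScalars F L X.carrier
  haveI : IsScalarTower F L X.carrier := IsScalarTower.restrictScalars F L X.carrier
  { carrier := X.carrier
    finite := Module.Finite.trans L X.carrier
    form := s.compQuadraticMap' X.form
    nonsingular := transfer_nonsingular hs X.nonsingular }

theorem QuadSpace.transfer_hyperbolic (s : L →ₗ[F] F) (hs : s ≠ 0) {X : QuadSpace L}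
    (h : IsHyperbolic X.form) : IsHyperbolic (X.transfer s hs).form :=
  let _ : Module F X.carrier := Module.restrictScalars F L X.carrier
  have _ : IsScalarTower F L X.carrier := IsScalarTower.restrictScalars F L X.carrier
  transfer_isHyperbolic (V := X.carrier) hs X.nonsingular h

theorem QuadSpace.transfer_isometry (s : L →ₗ[F] F) (hs : s ≠ 0) {X Y : QuadSpace L}
    (h : X.form.Equivalent Y.form) :
    (X.transfer s hs).form.Equivalent (Y.transfer s hs).form := by
  obtain ⟨e⟩ := h
  let _ : Module F X.carrier := Module.restrictScalars F L X.carrier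
  have _ : IsScalarTower F L X.carrier := IsScalarTower.restrictScalars F L X.carrier
  let _ : Module F Y.carrier := Module.restrictScalars F L Y.carrier
  have _ : IsScalarTower F L Y.carrier := IsScalarTower.restrictScalars F L Y.carrier
  exact ⟨⟨e.toLinearEquiv.restrictScalars F, fun x => congr_arg s (e.map_app' x)⟩⟩

theorem QuadSpace.transfer_sum (s : L →ₗ[F] F) (hs : s ≠ 0) (X Y : QuadSpace L) :
    ((X.sum Y).transfer s hs).form.Equivalent ((X.transfer s hs).sum (Y.transfer s hs)).form := by
  let e : ((X.sum Y).transfer s hs).carrier ≃ₗ[F]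
      ((X.transfer s hs).sum (Y.transfer s hs)).carrier :=
    { toFun := fun x => x
      invFun := fun x => x
      map_add' := fun _ _ => rfl
      map_smul' := fun _ _ => rfl
      left_inv := fun _ => rfl
      right_inv := fun _ => rfl }
  exact ⟨⟨e, fun x => (map_add s _ _).symm⟩⟩

theorem QuadSpace.WittEquiv.transfer (s : L →ₗ[F] F) (hs : s ≠ 0) {X Y : QuadSpace L}
    (h : X.WittEquiv Y) : (X.transfer s hs).WittEquiv (Y.transfer s hs) := by
  obtain ⟨M, N, hM, hN, e⟩ := h
  exact ⟨M.transfer s hs, N.transfer s hs, QuadSpace.transfer_hyperbolic s hs hM,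
    QuadSpace.transfer_hyperbolic s hs hN, (QuadSpace.transfer_sum s hs X M).symm.trans
      ((QuadSpace.transfer_isometry s hs e).trans (QuadSpace.transfer_sum s hs Y N))⟩

/-- The Scharlau transfer `W_q(L) → W_q(F)` induced by a nonzero `F`-linear map `s : L → F`. -/
def scharlauTransfer (s : L →ₗ[F] F) (hs : s ≠ 0) : QuadWitt L →+ QuadWitt F where
  toFun := Quotient.map (QuadSpace.transfer s hs) fun _ _ h => QuadSpace.WittEquiv.transfer s hs h
  map_zero' := QuadWitt.mk_eq.2
    (.of_hyperbolic (QuadSpace.transfer_hyperbolic s hs QuadSpace.zero_hyperbolic))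
  map_add' a b := by
    induction a using QuadWitt.ind with | _ X
    induction b using QuadWitt.ind with | _ Y
    exact QuadWitt.mk_eq_of_isometry (QuadSpace.transfer_sum s hs X Y)

theorem scharlauTransfer_mk (s : L →ₗ[F] F) (hs : s ≠ 0) (X : QuadSpace L) :
    scharlauTransfer s hs (QuadWitt.mk X) = QuadWitt.mk (X.transfer s hs) := rfl

end Transfer

section AdjoinRoot

open Polynomial

variable {F : Type u} [Field F]

/-- For `p` monic of degree `d`, the linear functional on `F[x]/(p)` that sends the class of a
polynomial `f` to the coefficient of `x^(d-1)` in the remainder of `f` modulo `p`. -/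
def topCoeff {p : F[X]} (hp : p.Monic) : AdjoinRoot p →ₗ[F] F :=
  Polynomial.lcoeff F (p.natDegree - 1) ∘ₗ AdjoinRoot.modByMonicHom hp

theorem topCoeff_root_pow {p : F[X]} (hp : p.Monic) {i : ℕ} (hi : i < p.natDegree) :
    topCoeff hp (AdjoinRoot.root p ^ i) = if i = p.natDegree - 1 then 1 else 0 := by
  have h : AdjoinRoot.root p ^ i = AdjoinRoot.mk p (X ^ i) := by simp
  have h2 : (X ^ i : F[X]) %ₘ p = X ^ i := by
    rw [Polynomial.modByMonic_eq_self_iff hp, degree_X_pow, degree_eq_natDegree hp.ne_zero]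
    exact_mod_cast hi
  rw [h, topCoeff, LinearMap.comp_apply, AdjoinRoot.modByMonicHom_mk, h2, lcoeff_apply,
    coeff_X_pow]
  simp [eq_comm]

theorem topCoeff_ne_zero {p : F[X]} (hp : p.Monic) (hirr : Irreducible p) : topCoeff hp ≠ 0 := by
  intro h
  have hd := hirr.natDegree_pos
  have := topCoeff_root_pow hp (i := p.natDegree - 1) (by omega)
  simp [h] at this

/-- For `p` monic irreducible, the Scharlau transfer `W_q(F[x]/(p)) → W_q(F)` induced by
`topCoeff`. -/
def polyTransfer {p : F[X]} [hirr : Fact (Irreducible p)] (hp : p.Monic) :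
    QuadWitt (AdjoinRoot p) →+ QuadWitt F :=
  haveI : FiniteDimensional F (AdjoinRoot p) := hp.finite_adjoinRoot
  scharlauTransfer (topCoeff hp) (topCoeff_ne_zero hp hirr.out)

end AdjoinRoot

end WittTheory

end

/-!
Write `δ(x) = x ⊗ 1 - 1 ⊗ x` in `L ⊗ L`, a tensor product over `ℤ`. The classes `[a, c]` generate
`W_q(L)` and are biadditive in `a` and `c`, so `a ⊗ c ↦ [a, c]` defines a surjection
`L ⊗ L → W_q(L)`. Multiplication by `⟨d⟩ - 1` lifts to multiplication by `δ(d)` up to a unit, so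
`I(L)ⁿ W_q(L)` lies in the image of `Jⁿ`, where `J` is the ideal generated by all `δ(d)`. The ideal
`N` generated by the `δ(x²)` is mapped to zero, since `[x²a, c] = [a, x²c]`. Let `J_F` be the ideal
generated by the `δ(d)` with `d ∈ F`; these factors can be pulled through the transfer by Frobenius
reciprocity.

If `L / F` is separable, then `L = F[L²]`, so `J = J_F + N` and `Jⁿ ≤ J_Fⁿ + N`, which gives the
claim. If `L = F(α)` is purely inseparable of even degree, then `δ(α)² = δ(α²) ∈ N`, so only
`Jⁿ⁺¹ ≤ J_Fⁿ + N`. The lost factor is regained because the transfer takes values in `I(F) W_q(F)`: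
every `[a, c]` is some `⟨a⟩ [1, b]` with `b ∈ F`, whose transfer is `s_*⟨a⟩ [1, b]`, and
`s_*⟨a⟩` has dimension `[L : F]`. A finite extension is a tower of extensions of these two kinds,
and every functional on `L` factors through every intermediate field.
-/


noncomputable section

namespace WittTheory

open TensorProduct
open LinearMap (BilinForm)

universe u

/-! ### Orthogonal splitting -/

section Splitting

variable {F : Type*} [Field F] {V W : Type*} [AddCommGroup V] [Module F V] [AddCommGroup W]
  [Module F W]

theorem exists_apply_eq_one {B : BilinForm F V} (hB : B.SeparatingLeft) {v : V} (hv : v ≠ 0) :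
    ∃ w, B v w = 1 := by
  obtain ⟨y, hy⟩ : ∃ y, B v y ≠ 0 := by
    by_contra! h
    exact hv (hB v h)
  exact ⟨(B v y)⁻¹ • y, by rw [map_smul, smul_eq_mul, inv_mul_cancel₀ hy]⟩

variable {B : BilinForm F V} {C : BilinForm F W} {φ : W →ₗ[F] V}

theorem injective_of_isometric (hC : C.SeparatingLeft) (h : ∀ x y, B (φ x) (φ y) = C x y) :
    Function.Injective φ := by
  rw [injective_iff_map_eq_zero]
  intro x hx
  exact hC x fun y => by rw [← h, hx, map_zero, LinearMap.zero_apply]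

theorem restrict_range_nondegenerate (hBs : ∀ x y, B x y = B y x) (hC : C.SeparatingLeft)
    (h : ∀ x y, B (φ x) (φ y) = C x y) : (B.restrict (LinearMap.range φ)).Nondegenerate := by
  refine nondeg_of_symm (fun x y => hBs x y) ?_
  rintro ⟨_, x, rfl⟩ hx
  have hx0 : x = 0 := hC x fun y => by
    rw [← h]
    exact hx ⟨φ y, y, rfl⟩
  simp [hx0]

variable [FiniteDimensional F V]

theorem restrict_orthogonal_nondegenerate (hB : B.Nondegenerate) (hBs : ∀ x y, B x y = B y x)
    {U : Submodule F V} (hU : (B.restrict U).Nondegenerate) :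
    (B.restrict (B.orthogonal U)).Nondegenerate := by
  have hrefl : B.IsRefl := fun x y hxy => by rw [hBs, hxy]
  rw [BilinForm.restrict_nondegenerate_iff_isCompl_orthogonal hrefl,
    BilinForm.orthogonal_orthogonal hB hrefl]
  exact (BilinForm.isCompl_orthogonal_of_restrict_nondegenerate hrefl hU).symm

theorem exists_linearEquiv_prod_orthogonal (hBs : ∀ x y, B x y = B y x) (hC : C.SeparatingLeft)
    (h : ∀ x y, B (φ x) (φ y) = C x y) :
    ∃ e : (W × B.orthogonal (LinearMap.range φ)) ≃ₗ[F] V, ∀ x, e x = φ x.1 + x.2 :=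
  have hcompl := BilinForm.isCompl_orthogonal_of_restrict_nondegenerate
    (fun x y hxy => by rw [hBs, hxy]) (restrict_range_nondegenerate hBs hC h)
  ⟨(LinearEquiv.ofInjective φ (injective_of_isometric hC h)).prodCongr (.refl F _) ≪≫ₗ
    Submodule.prodEquivOfIsCompl _ _ hcompl, fun _ => rfl⟩

end Splitting

section Generators

variable {F : Type u} [Field F]

theorem WittRing.exists_mk_eq_add (X Y : BilinSpace F) (φ : Y.carrier →ₗ[F] X.carrier)
    (h : ∀ x y, X.form (φ x) (φ y) = Y.form x y) :
    ∃ Z : BilinSpace F, mk X = mk Y + mk Z ∧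
      Module.finrank F X.carrier = Module.finrank F Y.carrier + Module.finrank F Z.carrier := by
  obtain ⟨e, he⟩ := exists_linearEquiv_prod_orthogonal X.symm Y.nondegenerate.1 h
  let Z : BilinSpace F :=
    { carrier := X.form.orthogonal (LinearMap.range φ)
      form := X.form.restrict _
      symm := fun x y => X.symm x y
      nondegenerate := restrict_orthogonal_nondegenerate X.nondegenerate X.symm
        (restrict_range_nondegenerate X.symm Y.nondegenerate.1 h) }
  have hform : (Y.sum Z).form.Equivalent X.form := by
    refine ⟨⟨e, ?_⟩⟩
    rintro ⟨y, z⟩ ⟨y', z'⟩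
    have hz : X.form (φ y') z = 0 := z.2 _ ⟨y', rfl⟩
    have hz' : X.form (φ y) z' = 0 := z'.2 _ ⟨y, rfl⟩
    change X.form (e (y, z)) (e (y', z')) = Y.form y y' + X.form z z'
    rw [he, he, map_add, map_add, LinearMap.add_apply, LinearMap.add_apply, h, hz',
      X.symm z, hz, add_zero, zero_add]
  exact ⟨Z, (mk_eq_of_isometry hform).symm, e.finrank_eq.symm.trans (Module.finrank_prod ..)⟩

theorem QuadWitt.exists_mk_eq_add (X Y : QuadSpace F) (φ : Y.carrier →ₗ[F] X.carrier)
    (h : ∀ x, X.form (φ x) = Y.form x) :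
    ∃ Z : QuadSpace F, mk X = mk Y + mk Z ∧
      Module.finrank F X.carrier = Module.finrank F Y.carrier + Module.finrank F Z.carrier := by
  have hpolar : ∀ x y, X.form.polarBilin (φ x) (φ y) = Y.form.polarBilin x y := fun x y => by
    simp [QuadraticMap.polar, ← map_add, h]
  have hs := polarBilin_symm X.form
  obtain ⟨e, he⟩ := exists_linearEquiv_prod_orthogonal hs Y.nonsingular.1 hpolar
  let Z : QuadSpace F :=
    { carrier := BilinForm.orthogonal X.form.polarBilin (LinearMap.range φ)
      form := X.form.restrict _
      nonsingular := restrict_orthogonal_nondegenerate X.nonsingular hs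
        (restrict_range_nondegenerate hs Y.nonsingular.1 hpolar) }
  have hform : (Y.sum Z).form.Equivalent X.form := by
    refine ⟨⟨e, ?_⟩⟩
    rintro ⟨y, z⟩
    have hz : X.form.polarBilin (φ y) z = 0 := z.2 _ ⟨y, rfl⟩
    change X.form (e (y, z)) = Y.form y + X.form z
    rw [he, QuadraticMap.map_add X.form, ← QuadraticMap.polarBilin_apply_apply, hz, add_zero, h]
  exact ⟨Z, (mk_eq_of_isometry hform).symm, e.finrank_eq.symm.trans (Module.finrank_prod ..)⟩

/-! ### Generators of the Witt ring -/

/-- The one-dimensional form `⟨d⟩`. -/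
def BilinSpace.angle (d : Fˣ) : BilinSpace F where
  carrier := F
  form := (d : F) • LinearMap.mul F F
  symm x y := by simp [mul_comm x]
  nondegenerate := nondeg_of_symm (fun x y => by simp [mul_comm x]) fun x hx => by
    simpa using hx 1

/-- The symmetric bilinear form with Gram matrix `[[0, 1], [1, 0]]`. -/
def planeForm (F : Type u) [Field F] : BilinForm F (F × F) :=
  (LinearMap.mul F F).compl₁₂ (LinearMap.fst F F F) (LinearMap.snd F F F) +
    (LinearMap.mul F F).compl₁₂ (LinearMap.snd F F F) (LinearMap.fst F F F)

theorem planeForm_apply (x y : F × F) : planeForm F x y = x.1 * y.2 + x.2 * y.1 := rfl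

theorem planeForm_symm (x y : F × F) : planeForm F x y = planeForm F y x := by
  rw [planeForm_apply, planeForm_apply]
  ring

theorem planeForm_isMetabolic : IsMetabolic (planeForm F) := by
  refine ⟨LinearMap.range (LinearMap.inl F F F), ?_, ?_⟩
  · rintro _ ⟨x, rfl⟩ _ ⟨y, rfl⟩
    simp [planeForm_apply]
  · rw [LinearMap.finrank_range_of_inj LinearMap.inl_injective]
    simp

/-- The bilinear plane with Gram matrix `[[0, 1], [1, 0]]`, which splits off every nonzero
alternating form. -/
def BilinSpace.plane (F : Type u) [Field F] : BilinSpace F where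
  carrier := F × F
  form := planeForm F
  symm := planeForm_symm
  nondegenerate := nondeg_of_symm planeForm_symm fun x hx => Prod.ext
    (by simpa [planeForm_apply] using hx (0, 1)) (by simpa [planeForm_apply] using hx (1, 0))

namespace WittRing

/-- The class of `⟨d⟩` in the Witt ring. -/
def angle (d : Fˣ) : WittRing F := mk (.angle d)

theorem mk_plane : mk (.plane F) = 0 := mk_eq.2 (.of_metabolic planeForm_isMetabolic)

theorem mk_eq_zero_of_subsingleton (X : BilinSpace F) [Subsingleton X.carrier] : mk X = 0 := by
  refine mk_eq.2 (.of_metabolic ⟨⊥, fun x _ y _ => ?_, ?_⟩)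
  · rw [Subsingleton.elim x 0, map_zero, LinearMap.zero_apply]
  · rw [Module.finrank_zero_of_subsingleton, finrank_bot]

theorem exists_mk_eq_angle_add (X : BilinSpace F) {v : X.carrier} (hv : X.form v v ≠ 0) :
    ∃ (d : Fˣ) (Z : BilinSpace F), mk X = angle d + mk Z ∧
      Module.finrank F X.carrier = 1 + Module.finrank F Z.carrier := by
  let d := Units.mk0 _ hv
  have h : ∀ x y : F, X.form (x • v) (y • v) = d * (x * y) := fun x y => by
    rw [map_smul, map_smul, LinearMap.smul_apply, smul_eq_mul, smul_eq_mul, Units.val_mk0]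
    ring
  obtain ⟨Z, hZ, hdim⟩ := exists_mk_eq_add X (.angle d) (LinearMap.toSpanSingleton F _ v) h
  exact ⟨d, Z, hZ, hdim.trans (congrArg (· + _) (Module.finrank_self F))⟩

theorem exists_mk_eq_of_alternating (X : BilinSpace F) [Nontrivial X.carrier]
    (halt : ∀ v, X.form v v = 0) :
    ∃ Z : BilinSpace F, mk X = mk Z ∧
      Module.finrank F X.carrier = 2 + Module.finrank F Z.carrier := by
  obtain ⟨v, hv⟩ := exists_ne (0 : X.carrier)
  obtain ⟨w, hw⟩ := exists_apply_eq_one X.nondegenerate.1 hv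
  let φ : F × F →ₗ[F] X.carrier :=
    (LinearMap.toSpanSingleton F _ v).coprod (LinearMap.toSpanSingleton F _ w)
  have h : ∀ x y, X.form (φ x) (φ y) = planeForm F x y := fun x y => by
    simp only [φ, LinearMap.coprod_apply, LinearMap.toSpanSingleton_apply, map_add, map_smul,
      LinearMap.add_apply, LinearMap.smul_apply, halt, hw, X.symm w v, smul_eq_mul,
      planeForm_apply]
    ring
  obtain ⟨Z, hZ, hdim⟩ := exists_mk_eq_add X (.plane F) φ h
  refine ⟨Z, by rw [hZ, mk_plane, zero_add], hdim.trans (congrArg (· + _) ?_)⟩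
  exact (Module.finrank_prod ..).trans (by rw [Module.finrank_self])

theorem mk_mem_closure_range_angle (X : BilinSpace F) :
    mk X ∈ AddSubgroup.closure (Set.range (angle (F := F))) := by
  induction hn : Module.finrank F X.carrier using Nat.strong_induction_on generalizing X with
  | _ n ih =>
    by_cases haniso : ∃ v, X.form v v ≠ 0
    · obtain ⟨v, hv⟩ := haniso
      obtain ⟨d, Z, hZ, hdim⟩ := exists_mk_eq_angle_add X hv
      rw [hZ]
      exact add_mem (AddSubgroup.subset_closure ⟨d, rfl⟩) (ih _ (by omega) Z rfl)
    push Not at haniso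
    rcases subsingleton_or_nontrivial X.carrier with htriv | hnontriv
    · rw [mk_eq_zero_of_subsingleton]
      exact zero_mem _
    · obtain ⟨Z, hZ, hdim⟩ := exists_mk_eq_of_alternating X haniso
      rw [hZ]
      exact ih _ (by omega) Z rfl

theorem closure_range_angle : AddSubgroup.closure (Set.range (angle (F := F))) = ⊤ :=
  eq_top_iff.2 fun w _ => ind mk_mem_closure_range_angle w

theorem smul_mem_of_angle_smul_mem {M : Type*} [AddCommGroup M] [Module (WittRing F) M]
    {Q : AddSubgroup M} (hQ : ∀ d : Fˣ, ∀ x ∈ Q, angle d • x ∈ Q) (w : WittRing F) {x : M}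
    (hx : x ∈ Q) : w • x ∈ Q := by
  have hw : w ∈ AddSubgroup.closure (Set.range (angle (F := F))) := by
    rw [closure_range_angle]
    exact AddSubgroup.mem_top w
  induction hw using AddSubgroup.closure_induction with
  | mem w hw =>
    obtain ⟨d, rfl⟩ := hw
    exact hQ d x hx
  | zero => simpa only [zero_smul] using zero_mem Q
  | add w w' _ _ hw hw' => simpa only [add_smul] using add_mem hw hw'
  | neg w _ hw => simpa only [neg_smul] using neg_mem hw

theorem dimIndex_angle (d : Fˣ) : dimIndex F (angle d) = 1 :=
  (congrArg Nat.cast (Module.finrank_self F)).trans Nat.cast_one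

theorem angle_sq (d : Fˣ) : angle (d ^ 2) = 1 := by
  have h : BilinForm.Equivalent (((d ^ 2 : Fˣ) : F) • LinearMap.mul F F) (LinearMap.mul F F) := by
    refine ⟨⟨LinearEquiv.smulOfUnit d, fun x y => ?_⟩⟩
    change (d : F) * x * ((d : F) * y) = ((d ^ 2 : Fˣ) : F) * (x * y)
    rw [Units.val_pow_eq_pow_val]
    ring
  exact mk_eq_of_isometry h

theorem angle_neg_one : angle (-1 : Fˣ) = -1 := by
  have h : BilinForm.Equivalent (((-1 : Fˣ) : F) • LinearMap.mul F F) (-LinearMap.mul F F) := by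
    refine ⟨⟨LinearEquiv.refl F F, fun x y => ?_⟩⟩
    change -(x * y) = ((-1 : Fˣ) : F) * (x * y)
    rw [Units.val_neg, Units.val_one, neg_one_mul]
  exact mk_eq_of_isometry h

theorem exists_sub_intCast_mem_span (w : WittRing F) :
    ∃ n : ℤ, w - n ∈ Ideal.span (Set.range fun d : Fˣ => angle d - 1) := by
  have hw : w ∈ AddSubgroup.closure (Set.range (angle (F := F))) := by
    rw [closure_range_angle]
    exact AddSubgroup.mem_top w
  induction hw using AddSubgroup.closure_induction with
  | mem w hw =>
    obtain ⟨d, rfl⟩ := hw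
    exact ⟨1, Ideal.subset_span ⟨d, by simp⟩⟩
  | zero => exact ⟨0, by simp⟩
  | add w w' _ _ hw hw' =>
    obtain ⟨n, hn⟩ := hw
    obtain ⟨n', hn'⟩ := hw'
    exact ⟨n + n', by simpa only [Int.cast_add, add_sub_add_comm] using add_mem hn hn'⟩
  | neg w _ hw =>
    obtain ⟨n, hn⟩ := hw
    exact ⟨-n, by simpa only [Int.cast_neg, neg_sub_neg, neg_sub] using neg_mem hn⟩

theorem fundamentalIdeal_eq_span :
    fundamentalIdeal F = Ideal.span (Set.range fun d : Fˣ => angle d - 1) := by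
  have hle : Ideal.span (Set.range fun d : Fˣ => angle d - 1) ≤ fundamentalIdeal F := by
    rw [Ideal.span_le]
    rintro _ ⟨d, rfl⟩
    rw [SetLike.mem_coe, fundamentalIdeal, RingHom.mem_ker, map_sub, map_one, dimIndex_angle,
      sub_self]
  refine le_antisymm (fun w hw => ?_) hle
  obtain ⟨n, hn⟩ := exists_sub_intCast_mem_span w
  have heven : (2 : ℤ) ∣ n := by
    have h : dimIndex F (w - n) = 0 := hle hn
    rw [map_sub, map_intCast, show dimIndex F w = 0 from hw, zero_sub, neg_eq_zero] at h
    exact (ZMod.intCast_zmod_eq_zero_iff_dvd n 2).1 h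
  have htwo : (2 : WittRing F) ∈ Ideal.span (Set.range fun d : Fˣ => angle d - 1) := by
    rw [show (2 : WittRing F) = -(angle (-1) - 1) by rw [angle_neg_one]; ring]
    exact neg_mem (Ideal.subset_span (Set.mem_range_self (-1)))
  obtain ⟨k, rfl⟩ := heven
  have h := add_mem hn (Ideal.mul_mem_right (k : WittRing F) _ htwo)
  rwa [Int.cast_mul, Int.cast_ofNat, sub_add_cancel] at h

end WittRing

end Generators

/-! ### Generators of the quadratic Witt group -/

section QuadraticGenerators

variable {F : Type u} [Field F]

/-- The quadratic form `a X² + X Y + c Y²`, usually written `[a, c]`. -/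
def binaryForm (a c : F) : QuadraticForm F (F × F) :=
  a • QuadraticMap.linMulLin (LinearMap.fst F F F) (LinearMap.fst F F F) +
    QuadraticMap.linMulLin (LinearMap.fst F F F) (LinearMap.snd F F F) +
    c • QuadraticMap.linMulLin (LinearMap.snd F F F) (LinearMap.snd F F F)

theorem binaryForm_apply (a c : F) (x : F × F) :
    binaryForm a c x = a * x.1 ^ 2 + x.1 * x.2 + c * x.2 ^ 2 := by
  simp [binaryForm, sq]

theorem binaryForm_polarBilin [CharP F 2] (a c : F) (x y : F × F) :
    (binaryForm a c).polarBilin x y = x.1 * y.2 + y.1 * x.2 := by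
  rw [QuadraticMap.polarBilin_apply_apply, QuadraticMap.polar, binaryForm_apply,
    binaryForm_apply, binaryForm_apply, Prod.fst_add, Prod.snd_add]
  linear_combination (a * x.1 * y.1 + c * x.2 * y.2) * CharTwo.two_eq_zero (R := F)

/-- The plane with the form `[a, c]`. -/
def QuadSpace.binary [CharP F 2] (a c : F) : QuadSpace F where
  carrier := F × F
  form := binaryForm a c
  nonsingular := nondeg_of_symm (polarBilin_symm _) fun x hx => by
    simp only [binaryForm_polarBilin] at hx
    exact Prod.ext (by simpa using hx (0, 1)) (by simpa using hx (1, 0))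

/-- The space `X` with its form multiplied by `d`; it represents the product `⟨d⟩ • X`. -/
def QuadSpace.scale (d : Fˣ) (X : QuadSpace F) : QuadSpace F where
  carrier := X.carrier
  form := (d : F) • X.form
  nonsingular := nondeg_of_symm (polarBilin_symm _) fun x hx => X.nonsingular.1 x fun y => by
    simpa [QuadraticMap.polar_smul] using hx y

namespace QuadWitt

theorem smul_mul_tensorQuad_equivalent {V : Type*} [AddCommGroup V] [Module F V] (d : F)
    (q : QuadraticForm F V) :
    (bilinTensorQuad (d • LinearMap.mul F F) q).Equivalent (d • q) := by
  refine equivalent_of_tensor (fun x y => by simp [mul_comm x]) (TensorProduct.lid F V) ?_ ?_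
  · intro v w
    simp [QuadraticMap.map_smul, mul_assoc]
  · intro v w v' w'
    simp only [QuadraticMap.polarBilin_apply_apply, FunLike.coe_smul,
      QuadraticMap.polar_smul, TensorProduct.lid_tmul, QuadraticMap.polar_smul_left,
      QuadraticMap.polar_smul_right, LinearMap.smul_apply, LinearMap.mul_apply', smul_eq_mul]
    ring

theorem angle_smul_mk (d : Fˣ) (X : QuadSpace F) : WittRing.angle d • mk X = mk (X.scale d) :=
  mk_eq_of_isometry (smul_mul_tensorQuad_equivalent (d : F) X.form)

theorem mk_eq_zero_of_subsingleton (X : QuadSpace F) [Subsingleton X.carrier] : mk X = 0 := by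
  refine mk_eq.2 (.of_hyperbolic (X.isHyperbolic_of_lagrangian ⊥ (fun x _ => ?_) ?_))
  · rw [Subsingleton.elim x 0, QuadraticMap.map_zero]
  · rw [Module.finrank_zero_of_subsingleton, finrank_bot]

variable [CharP F 2]

/-- The class of `[a, c]` in the quadratic Witt group. -/
def binary (a c : F) : QuadWitt F := mk (.binary a c)

theorem exists_mk_eq_binary_add (X : QuadSpace F) [Nontrivial X.carrier] :
    ∃ (a c : F) (Z : QuadSpace F), mk X = binary a c + mk Z ∧
      Module.finrank F X.carrier = 2 + Module.finrank F Z.carrier := by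
  obtain ⟨v, hv⟩ := exists_ne (0 : X.carrier)
  obtain ⟨w, hw⟩ := exists_apply_eq_one X.nonsingular.1 hv
  rw [QuadraticMap.polarBilin_apply_apply] at hw
  let φ : F × F →ₗ[F] X.carrier :=
    (LinearMap.toSpanSingleton F _ v).coprod (LinearMap.toSpanSingleton F _ w)
  have h : ∀ x, X.form (φ x) = binaryForm (X.form v) (X.form w) x := fun x => by
    simp only [φ, LinearMap.coprod_apply, LinearMap.toSpanSingleton_apply,
      QuadraticMap.map_add X.form, QuadraticMap.polar_smul_left, QuadraticMap.polar_smul_right,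
      hw, QuadraticMap.map_smul, smul_eq_mul, binaryForm_apply]
    ring
  obtain ⟨Z, hZ, hdim⟩ := exists_mk_eq_add X (.binary (X.form v) (X.form w)) φ h
  refine ⟨X.form v, X.form w, Z, hZ, hdim.trans (congrArg (· + _) ?_)⟩
  exact (Module.finrank_prod ..).trans (by rw [Module.finrank_self])

theorem mk_mem_closure_range_binary (X : QuadSpace F) :
    mk X ∈ AddSubgroup.closure (Set.range fun z : F × F => binary z.1 z.2) := by
  induction hn : Module.finrank F X.carrier using Nat.strong_induction_on generalizing X with
  | _ n ih =>
    rcases subsingleton_or_nontrivial X.carrier with htriv | hnontriv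
    · rw [mk_eq_zero_of_subsingleton]
      exact zero_mem _
    · obtain ⟨a, c, Z, hZ, hdim⟩ := exists_mk_eq_binary_add X
      rw [hZ]
      exact add_mem (AddSubgroup.subset_closure ⟨(a, c), rfl⟩) (ih _ (by omega) Z rfl)

theorem closure_range_binary :
    AddSubgroup.closure (Set.range fun z : F × F => binary z.1 z.2) = ⊤ :=
  eq_top_iff.2 fun w _ => ind mk_mem_closure_range_binary w

theorem binary_comm (a c : F) : binary a c = binary c a := by
  have h : (binaryForm a c).Equivalent (binaryForm c a) := by
    refine ⟨⟨LinearEquiv.prodComm F F F, fun x => ?_⟩⟩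
    change binaryForm c a (x.2, x.1) = binaryForm a c x
    rw [binaryForm_apply, binaryForm_apply]
    ring
  exact mk_eq_of_isometry h

theorem binary_zero_right (a : F) : binary a 0 = 0 := by
  have h : IsHyperbolic (binaryForm a 0) := by
    refine hyperbolic_of_lagrangian _ (QuadSpace.binary a 0).nonsingular
      (LinearMap.range (LinearMap.inr F F F)) ?_ ?_
    · rintro _ ⟨x, rfl⟩
      simp [binaryForm_apply]
    · rw [LinearMap.finrank_range_of_inj LinearMap.inr_injective]
      simp
  exact mk_eq.2 (.of_hyperbolic (X := .binary a 0) h)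

theorem binary_zero_left (c : F) : binary 0 c = 0 := by
  rw [binary_comm, binary_zero_right]

-- The isometry is `[a + a', c] ⊥ [a', 0] ≅ [a, c] ⊥ [a', c]`.
theorem binary_add_left (a a' c : F) : binary (a + a') c = binary a c + binary a' c := by
  let f : ((F × F) × (F × F)) →ₗ[F] ((F × F) × (F × F)) :=
    { toFun := fun z => ((z.1.1, z.1.2 + z.2.2), (z.1.1 + z.2.1, z.2.2))
      map_add' := fun x y => by ext <;> simp <;> ring
      map_smul' := fun x y => by ext <;> simp <;> ring }
  have hf : Function.Involutive f := fun x => by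
    ext <;> simp [f, add_assoc, ← add_assoc x.1.1 x.1.1, CharTwo.add_self_eq_zero]
  have h : QuadraticMap.Equivalent ((binaryForm (a + a') c).prod (binaryForm a' 0))
      ((binaryForm a c).prod (binaryForm a' c)) := by
    refine ⟨⟨LinearEquiv.ofInvolutive f hf, fun x => ?_⟩⟩
    change binaryForm a c (x.1.1, x.1.2 + x.2.2) + binaryForm a' c (x.1.1 + x.2.1, x.2.2) =
      binaryForm (a + a') c x.1 + binaryForm a' 0 x.2
    simp only [binaryForm_apply]
    linear_combination (c * x.2.2 ^ 2 + a' * x.1.1 * x.2.1 + c * x.1.2 * x.2.2 +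
      x.1.1 * x.2.2) * CharTwo.two_eq_zero (R := F)
  calc binary (a + a') c = binary (a + a') c + binary a' 0 := by rw [binary_zero_right, add_zero]
    _ = binary a c + binary a' c := mk_eq_of_isometry h

theorem binary_add_right (a c c' : F) : binary a (c + c') = binary a c + binary a c' := by
  rw [binary_comm, binary_add_left, binary_comm c, binary_comm c']

theorem angle_smul_binary (d : Fˣ) (a c : F) :
    WittRing.angle d • binary a c = binary (d * a) ((d : F)⁻¹ * c) := by
  have h : QuadraticMap.Equivalent ((d : F) • binaryForm a c)
      (binaryForm (d * a) ((d : F)⁻¹ * c)) := by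
    refine ⟨⟨(LinearEquiv.refl F F).prodCongr (LinearEquiv.smulOfUnit d), fun x => ?_⟩⟩
    change binaryForm (d * a) ((d : F)⁻¹ * c) (x.1, (d : F) * x.2) = (d : F) * binaryForm a c x
    rw [binaryForm_apply, binaryForm_apply]
    field
  exact (angle_smul_mk d _).trans (mk_eq_of_isometry h)

theorem binary_sq_mul (x a c : F) : binary (x ^ 2 * a) c = binary a (x ^ 2 * c) := by
  by_cases hx : x = 0
  · rw [hx, zero_pow two_ne_zero, zero_mul, zero_mul, binary_zero_left, binary_zero_right]
  · have h := angle_smul_binary (Units.mk0 x hx ^ 2) a (x ^ 2 * c)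
    rw [WittRing.angle_sq, one_smul, Units.val_pow_eq_pow_val, Units.val_mk0,
      inv_mul_cancel_left₀ (pow_ne_zero 2 hx)] at h
    exact h.symm

theorem binary_one_sq (c : F) : binary 1 (c ^ 2) = binary 1 c := by
  have h : (binaryForm (c ^ 2) 1).Equivalent (binaryForm c 1) := by
    refine ⟨⟨(LinearEquiv.refl F F).skewProd (.refl F F) (c • .id), fun x => ?_⟩⟩
    change binaryForm c 1 (x.1, x.2 + c * x.1) = binaryForm (c ^ 2) 1 x
    rw [binaryForm_apply, binaryForm_apply]
    linear_combination (c * x.1 ^ 2 + c * x.1 * x.2) * CharTwo.two_eq_zero (R := F)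
  rw [binary_comm, binary_comm 1 c]
  exact mk_eq_of_isometry h

theorem binary_one_pow_two_pow (c : F) (n : ℕ) : binary 1 (c ^ 2 ^ n) = binary 1 c := by
  induction n with
  | zero => rw [pow_zero, pow_one]
  | succ n ih => rw [pow_succ, pow_mul, binary_one_sq, ih]

end QuadWitt

end QuadraticGenerators

/-! ### The tensor square -/

section Ideals

variable {R : Type*} [CommRing R]

theorem mem_of_mem_span_mul {S : Set R} {I : Ideal R} {Q : AddSubgroup R}
    (h : ∀ a ∈ S, ∀ y ∈ I, a * y ∈ Q) {z : R} (hz : z ∈ Ideal.span S * I) : z ∈ Q := by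
  induction hz using Submodule.mul_induction_on' with
  | mem_mul_mem a ha y hy =>
    induction ha using Submodule.span_induction generalizing y with
    | mem a ha => exact h a ha y hy
    | zero => simpa only [zero_mul] using zero_mem Q
    | add a b _ _ ha hb => simpa only [add_mul] using add_mem (ha y hy) (hb y hy)
    | smul c a _ ha =>
      rw [smul_eq_mul, mul_assoc, mul_left_comm]
      exact ha _ (I.mul_mem_left c hy)
  | add a _ b _ ha hb => exact add_mem ha hb

theorem ideal_pow_le_pow_sup {J K N : Ideal R} (h : J ≤ K ⊔ N) (n : ℕ) : J ^ n ≤ K ^ n ⊔ N := by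
  induction n with
  | zero => rw [pow_zero, pow_zero]; exact le_sup_left
  | succ n ih =>
    rw [pow_succ, pow_succ]
    calc J ^ n * J ≤ (K ^ n ⊔ N) * (K ⊔ N) := Ideal.mul_mono ih h
      _ = K ^ n * K ⊔ N * K ⊔ (K ^ n ⊔ N) * N := by rw [Ideal.mul_sup, Ideal.sup_mul]
      _ ≤ K ^ n * K ⊔ N :=
        sup_le (sup_le_sup_left Ideal.mul_le_left _) (le_sup_of_le_right Ideal.mul_le_right)

theorem ideal_pow_succ_le_pow_sup {J K D N : Ideal R} (h : J ≤ K ⊔ D ⊔ N) (hD : D * D ≤ N)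
    (n : ℕ) : J ^ (n + 1) ≤ K ^ n ⊔ N := by
  have hpow : ∀ n, (K ⊔ D) ^ (n + 1) ≤ K ^ n * (K ⊔ D) ⊔ N := by
    intro n
    induction n with
    | zero => rw [pow_one, pow_zero, one_mul]; exact le_sup_left
    | succ n ih =>
      have hsq : (K ⊔ D) * (K ⊔ D) ≤ K * (K ⊔ D) ⊔ N := by
        rw [Ideal.sup_mul K D, Ideal.mul_sup D, mul_comm D K]
        exact sup_le le_sup_left
          (sup_le_sup (Ideal.mul_mono_right le_sup_right) hD)
      calc (K ⊔ D) ^ (n + 2) ≤ (K ^ n * (K ⊔ D) ⊔ N) * (K ⊔ D) := by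
            rw [pow_succ]; exact Ideal.mul_mono_left ih
        _ ≤ K ^ n * (K * (K ⊔ D) ⊔ N) ⊔ N := by
            rw [Ideal.sup_mul, mul_assoc]
            exact sup_le_sup (Ideal.mul_mono_right hsq) Ideal.mul_le_left
        _ ≤ K ^ (n + 1) * (K ⊔ D) ⊔ N := by
            rw [Ideal.mul_sup, ← mul_assoc, ← pow_succ, sup_assoc]
            exact sup_le_sup_left (sup_le Ideal.mul_le_right le_rfl) _
  calc J ^ (n + 1) ≤ (K ⊔ D) ^ (n + 1) ⊔ N := ideal_pow_le_pow_sup h _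
    _ ≤ K ^ n * (K ⊔ D) ⊔ N := sup_le (hpow n) le_sup_right
    _ ≤ K ^ n ⊔ N := sup_le_sup_right Ideal.mul_le_left _

end Ideals

section TensorSquare

variable {R : Type*} [CommRing R]

/-- The difference `x ⊗ 1 - 1 ⊗ x` in the tensor square of `R`. -/
def tensorDiff (x : R) : R ⊗[ℤ] R := x ⊗ₜ 1 - 1 ⊗ₜ x

theorem tensorDiff_zero : tensorDiff (0 : R) = 0 := by
  rw [tensorDiff, zero_tmul, tmul_zero, sub_zero]

theorem tensorDiff_add (x y : R) : tensorDiff (x + y) = tensorDiff x + tensorDiff y := by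
  simp only [tensorDiff, add_tmul, tmul_add]
  abel

theorem tensorDiff_neg (x : R) : tensorDiff (-x) = -tensorDiff x := by
  rw [tensorDiff, tensorDiff, neg_tmul, tmul_neg, neg_sub_neg, neg_sub]

theorem tensorDiff_mul (x y : R) :
    tensorDiff (x * y) = (x ⊗ₜ 1) * tensorDiff y + (1 ⊗ₜ y) * tensorDiff x := by
  simp only [tensorDiff, mul_sub, Algebra.TensorProduct.tmul_mul_tmul, one_mul, mul_one]
  rw [mul_comm y x]
  abel

theorem tensorDiff_sq [CharP R 2] (x : R) : tensorDiff x ^ 2 = tensorDiff (x ^ 2) := by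
  have htwo : (2 : R ⊗[ℤ] R) = 0 := by
    rw [← map_ofNat (algebraMap R (R ⊗[ℤ] R)) 2, CharTwo.two_eq_zero, map_zero]
  have hleft : (x ^ 2) ⊗ₜ[ℤ] (1 : R) = (x ⊗ₜ 1) ^ 2 := by
    rw [Algebra.TensorProduct.tmul_pow, one_pow]
  have hright : (1 : R) ⊗ₜ[ℤ] (x ^ 2) = (1 ⊗ₜ x) ^ 2 := by
    rw [Algebra.TensorProduct.tmul_pow, one_pow]
  rw [tensorDiff, tensorDiff, hleft, hright]
  linear_combination ((1 ⊗ₜ x) ^ 2 - (x ⊗ₜ 1) * (1 ⊗ₜ x)) * htwo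

/-- The ideal of `R ⊗ R` generated by the differences `x ⊗ 1 - 1 ⊗ x` with `x ∈ S`. For
`S = Set.univ` it is the diagonal ideal, the kernel of the multiplication map. -/
def diffIdeal (S : Set R) : Ideal (R ⊗[ℤ] R) := Ideal.span (tensorDiff '' S)

theorem tensorDiff_mem_diffIdeal {S : Set R} {x : R} (hx : x ∈ S) : tensorDiff x ∈ diffIdeal S :=
  Ideal.subset_span ⟨x, hx, rfl⟩

theorem diffIdeal_union (S T : Set R) : diffIdeal (S ∪ T) = diffIdeal S ⊔ diffIdeal T := by
  rw [diffIdeal, Set.image_union, Ideal.span_union, diffIdeal, diffIdeal]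

theorem tensorDiff_mem_of_mem_closure {S : Set R} {x : R} (hx : x ∈ Subring.closure S) :
    tensorDiff x ∈ diffIdeal S := by
  induction hx using Subring.closure_induction with
  | mem x hx => exact tensorDiff_mem_diffIdeal hx
  | zero => rw [tensorDiff_zero]; exact zero_mem _
  | one => rw [tensorDiff, sub_self]; exact zero_mem _
  | add x y _ _ hx hy => rw [tensorDiff_add]; exact add_mem hx hy
  | neg x _ hx => rw [tensorDiff_neg]; exact neg_mem hx
  | mul x y _ _ hx hy =>
    rw [tensorDiff_mul]
    exact add_mem (Ideal.mul_mem_left _ _ hy) (Ideal.mul_mem_left _ _ hx)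

theorem diffIdeal_univ_eq_of_adjoin_eq_top {A : Type*} [CommRing A] [Algebra A R] {S : Set R}
    (h : Algebra.adjoin A S = ⊤) :
    diffIdeal Set.univ = diffIdeal (Set.range (algebraMap A R)) ⊔ diffIdeal S := by
  rw [← diffIdeal_union]
  refine le_antisymm (Ideal.span_le.2 ?_) (Ideal.span_mono (Set.image_mono (Set.subset_univ _)))
  rintro _ ⟨x, -, rfl⟩
  refine tensorDiff_mem_of_mem_closure ?_
  rw [← Algebra.adjoin_eq_ring_closure (R := A), h]
  exact Algebra.mem_top (R := A)

end TensorSquare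

/-! ### The symbol map onto the quadratic Witt group -/

section Symbol

variable {L : Type u} [Field L] [CharP L 2]

namespace QuadWitt

/-- The additive map `L ⊗ L → W_q(L)` that sends `a ⊗ c` to the class of `[a, c]`. -/
def symbol (L : Type u) [Field L] [CharP L 2] : L ⊗[ℤ] L →+ QuadWitt L :=
  TensorProduct.liftAddHom
    (AddMonoidHom.mk' (fun a => AddMonoidHom.mk' (binary a) (binary_add_right a))
      fun a a' => AddMonoidHom.ext fun c => binary_add_left a a' c)
    fun r a c => by
      rw [map_zsmul, map_zsmul]
      rfl

theorem symbol_tmul (a c : L) : symbol L (a ⊗ₜ c) = binary a c := rfl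

theorem symbol_surjective : Function.Surjective (symbol L) := by
  rw [← AddMonoidHom.range_eq_top, eq_top_iff, ← closure_range_binary, AddSubgroup.closure_le]
  rintro _ ⟨z, rfl⟩
  exact ⟨z.1 ⊗ₜ z.2, rfl⟩

theorem angle_smul_symbol (d : Lˣ) (z : L ⊗[ℤ] L) :
    WittRing.angle d • symbol L z = symbol L (((d : L) ⊗ₜ (d : L)⁻¹) * z) := by
  induction z with
  | zero => rw [mul_zero, map_zero, smul_zero]
  | tmul a c =>
    rw [Algebra.TensorProduct.tmul_mul_tmul, symbol_tmul, symbol_tmul, angle_smul_binary]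
  | add x y hx hy => rw [map_add, smul_add, hx, hy, mul_add, map_add]

theorem angle_sub_one_smul_symbol (d : Lˣ) (z : L ⊗[ℤ] L) :
    (WittRing.angle d - 1) • symbol L z =
      symbol L (tensorDiff (d : L) * ((1 ⊗ₜ (d : L)⁻¹) * z)) := by
  have h : (d : L) ⊗ₜ[ℤ] (d : L)⁻¹ - 1 = tensorDiff (d : L) * (1 ⊗ₜ (d : L)⁻¹) := by
    rw [tensorDiff, sub_mul, Algebra.TensorProduct.tmul_mul_tmul,
      Algebra.TensorProduct.tmul_mul_tmul, mul_one, one_mul, mul_one, mul_inv_cancel₀ d.ne_zero,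
      Algebra.TensorProduct.one_def]
  rw [sub_smul, one_smul, angle_smul_symbol, ← map_sub, ← mul_assoc, ← h, sub_mul, one_mul]

theorem symbol_tensorDiff_mul (d : Lˣ) (z : L ⊗[ℤ] L) :
    symbol L (tensorDiff (d : L) * z) =
      (WittRing.angle d - 1) • symbol L ((1 ⊗ₜ (d : L)) * z) := by
  rw [angle_sub_one_smul_symbol, ← mul_assoc (1 ⊗ₜ[ℤ] (d : L)⁻¹),
    Algebra.TensorProduct.tmul_mul_tmul, one_mul, inv_mul_cancel₀ d.ne_zero,
    ← Algebra.TensorProduct.one_def, one_mul]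

theorem symbol_tensorDiff_sq_mul (x : L) (z : L ⊗[ℤ] L) :
    symbol L (tensorDiff (x ^ 2) * z) = 0 := by
  induction z with
  | zero => rw [mul_zero, map_zero]
  | tmul a c =>
    rw [tensorDiff, sub_mul, map_sub, Algebra.TensorProduct.tmul_mul_tmul,
      Algebra.TensorProduct.tmul_mul_tmul, one_mul, one_mul, symbol_tmul, symbol_tmul,
      binary_sq_mul, sub_self]
  | add y y' hy hy' => rw [mul_add, map_add, hy, hy', add_zero]

theorem symbol_eq_zero_of_mem_diffIdeal_sq {z : L ⊗[ℤ] L}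
    (hz : z ∈ diffIdeal (Set.range fun x : L => x ^ 2)) : symbol L z = 0 := by
  rw [← Ideal.mul_top (diffIdeal (Set.range fun x : L => x ^ 2))] at hz
  refine mem_of_mem_span_mul (Q := (symbol L).ker) ?_ hz
  rintro _ ⟨_, ⟨x, rfl⟩, rfl⟩ y -
  exact symbol_tensorDiff_sq_mul x y

/-- The image of an ideal of the tensor square in the quadratic Witt group. -/
def symbolSubmodule (I : Ideal (L ⊗[ℤ] L)) : Submodule (WittRing L) (QuadWitt L) where
  toAddSubmonoid := (I.toAddSubgroup.map (symbol L)).toAddSubmonoid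
  smul_mem' w _ hx :=
    WittRing.smul_mem_of_angle_smul_mem (Q := I.toAddSubgroup.map (symbol L))
      (by
        rintro d _ ⟨z, hz, rfl⟩
        exact ⟨_, I.mul_mem_left _ hz, (angle_smul_symbol d z).symm⟩)
      w hx

theorem mem_symbolSubmodule {I : Ideal (L ⊗[ℤ] L)} {x : QuadWitt L} :
    x ∈ symbolSubmodule I ↔ ∃ z ∈ I, symbol L z = x := Iff.rfl

theorem fundamentalIdeal_smul_symbolSubmodule_le (I : Ideal (L ⊗[ℤ] L)) :
    WittRing.fundamentalIdeal L • symbolSubmodule I ≤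
      symbolSubmodule (diffIdeal Set.univ * I) := by
  rw [WittRing.fundamentalIdeal_eq_span, Submodule.span_smul_eq]
  refine Submodule.set_smul_le _ _ _ ?_
  rintro _ _ ⟨d, rfl⟩ ⟨z, hz, rfl⟩
  exact mem_symbolSubmodule.2 ⟨_, Ideal.mul_mem_mul (tensorDiff_mem_diffIdeal (Set.mem_univ _))
    (I.mul_mem_left _ hz), (angle_sub_one_smul_symbol d z).symm⟩

theorem Iq_succ_le_symbolSubmodule (n : ℕ) :
    Iq L (n + 1) ≤ symbolSubmodule (diffIdeal Set.univ ^ n) := by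
  rw [Iq, Nat.add_sub_cancel]
  induction n with
  | zero =>
    intro x _
    obtain ⟨z, rfl⟩ := symbol_surjective x
    exact mem_symbolSubmodule.2 ⟨z, by simp, rfl⟩
  | succ n ih =>
    rw [pow_succ' (WittRing.fundamentalIdeal L), mul_smul,
      pow_succ' (diffIdeal (Set.univ : Set L))]
    exact (smul_mono_right _ ih).trans (fundamentalIdeal_smul_symbolSubmodule_le _)

end QuadWitt

end Symbol

/-! ### The transfer and the symbol map -/

section Transfer

variable {F L : Type u} [Field F] [Field L] [Algebra F L] [FiniteDimensional F L]

theorem QuadSpace.transfer_equivalent (s : L →ₗ[F] F) (hs : s ≠ 0) {X : QuadSpace L}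
    {Y : QuadSpace F} (e : X.carrier ≃+ Y.carrier)
    (hsmul : ∀ (c : F) (x : X.carrier), e (algebraMap F L c • x) = c • e x)
    (hform : ∀ x, Y.form (e x) = s (X.form x)) :
    (X.transfer s hs).form.Equivalent Y.form :=
  let _ : Module F X.carrier := Module.restrictScalars F L X.carrier
  ⟨⟨{ e with map_smul' := hsmul }, hform⟩⟩

theorem scharlauTransfer_angle_smul (s : L →ₗ[F] F) (hs : s ≠ 0) (d : Fˣ) (x : QuadWitt L) :
    scharlauTransfer s hs (WittRing.angle (Units.map (algebraMap F L).toMonoidHom d) • x) =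
      WittRing.angle d • scharlauTransfer s hs x := by
  induction x using QuadWitt.ind with | _ X
  rw [QuadWitt.angle_smul_mk, scharlauTransfer_mk, scharlauTransfer_mk, QuadWitt.angle_smul_mk]
  refine QuadWitt.mk_eq_of_isometry
    (QuadSpace.transfer_equivalent s hs (AddEquiv.refl X.carrier) (fun _ _ => rfl) fun x => ?_)
  change (d : F) * s (X.form x) = s (algebraMap F L d * X.form x)
  rw [← Algebra.smul_def, map_smul, smul_eq_mul]

variable [CharP L 2]

open QuadWitt

theorem scharlauTransfer_symbol_mem_smul (s : L →ₗ[F] F) (hs : s ≠ 0) {I : Ideal (L ⊗[ℤ] L)}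
    {P : Submodule (WittRing F) (QuadWitt F)}
    (hP : ∀ z ∈ I, scharlauTransfer s hs (symbol L z) ∈ P) {z : L ⊗[ℤ] L}
    (hz : z ∈ diffIdeal (Set.range (algebraMap F L)) * I) :
    scharlauTransfer s hs (symbol L z) ∈ WittRing.fundamentalIdeal F • P := by
  let Q := (WittRing.fundamentalIdeal F • P).toAddSubgroup.comap
    ((scharlauTransfer s hs).comp (symbol L))
  refine mem_of_mem_span_mul (Q := Q) ?_ hz
  rintro _ ⟨_, ⟨d, rfl⟩, rfl⟩ y hy
  change scharlauTransfer s hs (symbol L (tensorDiff (algebraMap F L d) * y)) ∈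
    WittRing.fundamentalIdeal F • P
  by_cases hd : d = 0
  · rw [hd, map_zero, tensorDiff_zero, zero_mul, map_zero, map_zero]
    exact zero_mem _
  lift d to Fˣ using Ne.isUnit hd
  have hangle : symbol L (tensorDiff (algebraMap F L d) * y) =
      (WittRing.angle (Units.map (algebraMap F L).toMonoidHom d) - 1) •
        symbol L ((1 ⊗ₜ algebraMap F L d) * y) := by
    simpa only [Units.coe_map, RingHom.toMonoidHom_eq_coe, MonoidHom.coe_coe] using
      symbol_tensorDiff_mul (Units.map (algebraMap F L).toMonoidHom d) y
  rw [hangle, sub_smul, one_smul, map_sub, scharlauTransfer_angle_smul]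
  nth_rw 2 [← one_smul (WittRing F) (scharlauTransfer s hs _)]
  rw [← sub_smul]
  refine Submodule.smul_mem_smul ?_ (hP _ (I.mul_mem_left _ hy))
  rw [WittRing.fundamentalIdeal_eq_span]
  exact Ideal.subset_span ⟨d, rfl⟩

theorem scharlauTransfer_symbol_mem_pow_smul (s : L →ₗ[F] F) (hs : s ≠ 0)
    {P : Submodule (WittRing F) (QuadWitt F)} (hP : ∀ x, scharlauTransfer s hs x ∈ P) (n : ℕ)
    {z : L ⊗[ℤ] L} (hz : z ∈ diffIdeal (Set.range (algebraMap F L)) ^ n) :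
    scharlauTransfer s hs (symbol L z) ∈ WittRing.fundamentalIdeal F ^ n • P := by
  induction n generalizing z with
  | zero => simpa using hP _
  | succ n ih =>
    rw [pow_succ' (diffIdeal (Set.range (algebraMap F L)))] at hz
    rw [pow_succ' (WittRing.fundamentalIdeal F), mul_smul]
    exact scharlauTransfer_symbol_mem_smul s hs (fun z hz => ih hz) hz

theorem scharlauTransfer_mem_of_diffIdeal_pow_le (s : L →ₗ[F] F) (hs : s ≠ 0)
    {P : Submodule (WittRing F) (QuadWitt F)} (hP : ∀ x, scharlauTransfer s hs x ∈ P) {n k : ℕ}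
    (h : diffIdeal (Set.univ : Set L) ^ n ≤
      diffIdeal (Set.range (algebraMap F L)) ^ k ⊔ diffIdeal (Set.range fun x : L => x ^ 2))
    {x : QuadWitt L} (hx : x ∈ Iq L (n + 1)) :
    scharlauTransfer s hs x ∈ WittRing.fundamentalIdeal F ^ k • P := by
  obtain ⟨z, hz, rfl⟩ := mem_symbolSubmodule.1 (Iq_succ_le_symbolSubmodule n hx)
  obtain ⟨y, hy, w, hw, rfl⟩ := Submodule.mem_sup.1 (h hz)
  rw [map_add, symbol_eq_zero_of_mem_diffIdeal_sq hw, add_zero]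
  exact scharlauTransfer_symbol_mem_pow_smul s hs hP k hy

end Transfer

section Reciprocity

variable {F L : Type u} [Field F] [Field L] [Algebra F L]

theorem compr₂_mul_nondegenerate {s : L →ₗ[F] F} (hs : s ≠ 0) :
    BilinForm.Nondegenerate ((LinearMap.mul F L).compr₂ s) := by
  refine nondeg_of_symm (fun x y => congrArg s (mul_comm x y)) fun x hx => ?_
  by_contra hne
  refine hs (LinearMap.ext fun z => ?_)
  rw [← mul_inv_cancel_left₀ hne z]
  exact hx (x⁻¹ * z)

theorem comp_mulLeft_ne_zero {s : L →ₗ[F] F} (hs : s ≠ 0) (a : Lˣ) :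
    s ∘ₗ LinearMap.mulLeft F (a : L) ≠ 0 := fun h =>
  hs (LinearMap.ext fun z => by
    simpa using LinearMap.congr_fun h ((a : L)⁻¹ * z))

theorem exists_comp_restrictScalars_eq {E : Type u} [Field E] [Algebra F E] [Algebra E L]
    [IsScalarTower F E L] [FiniteDimensional F E] {r : E →ₗ[F] F} (hr : r ≠ 0) (s : L →ₗ[F] F) :
    ∃ t : L →ₗ[E] E, r ∘ₗ t.restrictScalars F = s := by
  have hB := compr₂_mul_nondegenerate hr
  let f : L → E := fun y =>
    (BilinForm.toDual _ hB).symm (s ∘ₗ (LinearMap.toSpanSingleton E L y).restrictScalars F)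
  have hf : ∀ y c, r (f y * c) = s (c • y) := fun y c =>
    BilinForm.apply_toDual_symm_apply (hB := hB) _ c
  have hunique : ∀ {y e}, (∀ c, r (e * c) = s (c • y)) → f y = e := fun {y e} he =>
    sub_eq_zero.1 (hB.1 _ fun c => by
      change r ((f y - e) * c) = 0
      rw [sub_mul, map_sub, hf, he, sub_self])
  refine ⟨{ toFun := f
            map_add' := fun y z => hunique fun c => ?_
            map_smul' := fun a y => hunique fun c => ?_ }, LinearMap.ext fun y => ?_⟩
  · rw [add_mul, map_add, hf, hf, smul_add, map_add]
  · rw [RingHom.id_apply, smul_eq_mul, mul_right_comm, mul_comm, hf, smul_smul, mul_comm c]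
  · simpa using hf y 1

theorem polarBilin_compQuadraticMap' {V : Type*} [AddCommGroup V] [Module L V] [Module F V]
    [IsScalarTower F L V] (s : L →ₗ[F] F) (q : QuadraticForm L V) (x y : V) :
    (s.compQuadraticMap' q).polarBilin x y = s (q.polarBilin x y) := by
  simp only [QuadraticMap.polarBilin_apply_apply, QuadraticMap.polar,
    LinearMap.compQuadraticMap'_apply, map_sub]

theorem mul_tensorQuad_binaryForm_equivalent [CharP F 2] [CharP L 2] (s : L →ₗ[F] F) (b c : F) :
    (bilinTensorQuad ((LinearMap.mul F L).compr₂ s) (binaryForm b c)).Equivalent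
      (s.compQuadraticMap' (binaryForm (algebraMap F L b) (algebraMap F L c))) := by
  let e : (L ⊗[F] (F × F)) ≃ₗ[F] (L × L) := TensorProduct.prodRight F F L F F ≪≫ₗ
    (TensorProduct.rid F L).prodCongr (TensorProduct.rid F L)
  have he : ∀ v w, e (v ⊗ₜ w) = (algebraMap F L w.1 * v, algebraMap F L w.2 * v) := by
    intro v w
    simp [e, Algebra.smul_def]
  have hB : ∀ v v', (LinearMap.mul F L).compr₂ s v v' = s (v * v') := fun _ _ => rfl
  have hs : ∀ (y : L) (d : F), s y * d = s (algebraMap F L d * y) := fun y d => by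
    rw [← Algebra.smul_def, map_smul, smul_eq_mul, mul_comm]
  refine equivalent_of_tensor (fun x y => congrArg s (mul_comm x y)) e ?_ ?_
  · intro v w
    rw [he, hB, hs, LinearMap.compQuadraticMap'_apply, binaryForm_apply, binaryForm_apply]
    congr 1
    simp only [map_add, map_mul, map_pow]
    ring
  · intro v w v' w'
    rw [polarBilin_compQuadraticMap', he, he, hB, hs, binaryForm_polarBilin, binaryForm_polarBilin]
    congr 1
    simp only [map_add, map_mul]
    ring

variable [FiniteDimensional F L]

open QuadWitt

/-- The transfer of the form `⟨1⟩` along `s`: the space `L` with the form `(x, y) ↦ s (x y)`. -/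
def BilinSpace.transferOne (s : L →ₗ[F] F) (hs : s ≠ 0) : BilinSpace F where
  carrier := L
  form := (LinearMap.mul F L).compr₂ s
  symm x y := congrArg s (mul_comm x y)
  nondegenerate := compr₂_mul_nondegenerate hs

theorem scharlauTransfer_binary_algebraMap [CharP F 2] [CharP L 2] (s : L →ₗ[F] F) (hs : s ≠ 0)
    (b c : F) : scharlauTransfer s hs (binary (algebraMap F L b) (algebraMap F L c)) =
      WittRing.mk (.transferOne s hs) • binary b c := by
  obtain ⟨e⟩ := mul_tensorQuad_binaryForm_equivalent s b c
  rw [binary, scharlauTransfer_mk, binary, mk_smul]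
  have hsmul : ∀ (d : F) (x : L × L), e.symm (algebraMap F L d • x) = d • e.symm x :=
    fun d x => by rw [algebraMap_smul]; exact map_smul e.symm.toLinearEquiv d x
  exact mk_eq_of_isometry
    (QuadSpace.transfer_equivalent s hs e.symm.toLinearEquiv.toAddEquiv hsmul e.symm.map_app)

theorem scharlauTransfer_comp_mulLeft (s : L →ₗ[F] F) (hs : s ≠ 0) (a : Lˣ) (x : QuadWitt L) :
    scharlauTransfer (s ∘ₗ LinearMap.mulLeft F (a : L)) (comp_mulLeft_ne_zero hs a) x =
      scharlauTransfer s hs (WittRing.angle a • x) := by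
  induction x using QuadWitt.ind with | _ X
  rw [angle_smul_mk, scharlauTransfer_mk, scharlauTransfer_mk]
  exact mk_eq_of_isometry (QuadSpace.transfer_equivalent _ _
    (Y := (X.scale a).transfer s hs) (AddEquiv.refl X.carrier) (fun _ _ => rfl) fun _ => rfl)

theorem scharlauTransfer_trans {E : Type u} [Field E] [Algebra F E] [Algebra E L]
    [IsScalarTower F E L] [FiniteDimensional F E] [FiniteDimensional E L]
    (r : E →ₗ[F] F) (hr : r ≠ 0) (t : L →ₗ[E] E) (ht : t ≠ 0)
    (hrt : r ∘ₗ t.restrictScalars F ≠ 0) (x : QuadWitt L) :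
    scharlauTransfer (r ∘ₗ t.restrictScalars F) hrt x =
      scharlauTransfer r hr (scharlauTransfer t ht x) := by
  induction x using QuadWitt.ind with | _ X
  rw [scharlauTransfer_mk, scharlauTransfer_mk, scharlauTransfer_mk]
  refine mk_eq_of_isometry (QuadSpace.transfer_equivalent _ _
    (Y := (X.transfer t ht).transfer r hr) (AddEquiv.refl X.carrier) (fun c x => ?_) fun _ => rfl)
  rw [IsScalarTower.algebraMap_apply F E L]
  rfl

end Reciprocity

/-! ### The transfer and the filtration -/

section Filtration

variable {F L : Type u} [Field F] [Field L] [Algebra F L] [FiniteDimensional F L]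

/-- All Scharlau transfers of the finite extension `L / F` respect the filtrations `Iq`. -/
def TransferPreservesIq (F L : Type u) [Field F] [Field L] [Algebra F L]
    [FiniteDimensional F L] : Prop :=
  ∀ (s : L →ₗ[F] F) (hs : s ≠ 0) (n : ℕ), ∀ x ∈ Iq L (n + 1), scharlauTransfer s hs x ∈ Iq F (n + 1)

namespace TransferPreservesIq

theorem trans {E : Type u} [Field E] [Algebra F E] [Algebra E L] [IsScalarTower F E L]
    [FiniteDimensional F E] [FiniteDimensional E L] (hFE : TransferPreservesIq F E)
    (hEL : TransferPreservesIq E L) : TransferPreservesIq F L := by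
  intro s hs n x hx
  obtain ⟨r, hr⟩ : ∃ r : E →ₗ[F] F, r ≠ 0 := exists_ne (0 : Module.Dual F E)
  obtain ⟨t, rfl⟩ := exists_comp_restrictScalars_eq hr s
  have ht : t ≠ 0 := by
    rintro rfl
    exact hs (LinearMap.ext fun _ => map_zero r)
  rw [scharlauTransfer_trans r hr t ht]
  exact hFE r hr n _ (hEL t ht n x hx)

theorem of_adjoin_sq [CharP L 2]
    (h : Algebra.adjoin F (Set.range fun x : L => x ^ 2) = ⊤) : TransferPreservesIq F L :=
  fun s hs n _ hx => scharlauTransfer_mem_of_diffIdeal_pow_le s hs (fun _ => Submodule.mem_top)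
    (ideal_pow_le_pow_sup (diffIdeal_univ_eq_of_adjoin_eq_top h).le n) hx

theorem of_isSeparable [CharP F 2] [Algebra.IsSeparable F L] : TransferPreservesIq F L := by
  have := charP_of_injective_algebraMap (algebraMap F L).injective 2
  refine of_adjoin_sq (eq_top_iff.2 fun x _ => ?_)
  have hsq : {x ^ 2} ⊆ Set.range fun y : L => y ^ 2 := Set.singleton_subset_iff.2 ⟨x, rfl⟩
  have hx : x ∈ IntermediateField.adjoin F {x ^ 2} :=
    IntermediateField.adjoin_simple_eq_adjoin_pow_expChar_of_isSeparable' F L x 2 ▸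
      IntermediateField.mem_adjoin_simple_self F x
  rw [← IntermediateField.mem_toSubalgebra,
    IntermediateField.adjoin_simple_toSubalgebra_of_isAlgebraic
      (Algebra.IsAlgebraic.isAlgebraic _)] at hx
  exact Algebra.adjoin_mono hsq hx

end TransferPreservesIq

open QuadWitt

theorem scharlauTransfer_mem_fundamentalIdeal_smul [CharP F 2] [IsPurelyInseparable F L]
    (hd : Even (Module.finrank F L)) (s : L →ₗ[F] F) (hs : s ≠ 0) (x : QuadWitt L) :
    scharlauTransfer s hs x ∈
      WittRing.fundamentalIdeal F • (⊤ : Submodule (WittRing F) (QuadWitt F)) := by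
  have := charP_of_injective_algebraMap (algebraMap F L).injective 2
  have hx : x ∈ AddSubgroup.closure (Set.range fun z : L × L => binary z.1 z.2) := by
    rw [closure_range_binary]
    exact AddSubgroup.mem_top x
  induction hx using AddSubgroup.closure_induction with
  | zero => rw [map_zero]; exact zero_mem _
  | add x y _ _ hx hy => rw [map_add]; exact add_mem hx hy
  | neg x _ hx => rw [map_neg]; exact neg_mem hx
  | mem x h =>
    obtain ⟨⟨a, c⟩, rfl⟩ := h
    dsimp only
    by_cases ha : a = 0
    · rw [ha, binary_zero_left, map_zero]
      exact zero_mem _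
    lift a to Lˣ using Ne.isUnit ha
    obtain ⟨n, b, hb⟩ := IsPurelyInseparable.pow_mem F 2 ((a : L) * c)
    have hbinary : binary (a : L) c =
        WittRing.angle a • binary (algebraMap F L 1) (algebraMap F L b) := by
      rw [hb, map_one, binary_one_pow_two_pow, angle_smul_binary, mul_one, inv_mul_cancel_left₀ ha]
    rw [hbinary, ← scharlauTransfer_comp_mulLeft, scharlauTransfer_binary_algebraMap]
    refine Submodule.smul_mem_smul ?_ Submodule.mem_top
    rw [WittRing.fundamentalIdeal, RingHom.mem_ker, WittRing.dimIndex_mk]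
    exact ZMod.natCast_eq_zero_iff_even.2 hd

namespace TransferPreservesIq

theorem of_isPurelyInseparable_of_adjoin_singleton [CharP F 2] [IsPurelyInseparable F L]
    (hd : Even (Module.finrank F L)) {α : L} (hα : Algebra.adjoin F {α} = ⊤) :
    TransferPreservesIq F L := by
  have := charP_of_injective_algebraMap (algebraMap F L).injective 2
  rintro s hs (_ | n) x hx
  · rw [Iq, zero_add, Nat.sub_self, pow_zero, one_smul]
    exact Submodule.mem_top
  have hsq : diffIdeal {α} * diffIdeal {α} ≤ diffIdeal (Set.range fun x : L => x ^ 2) := by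
    rw [diffIdeal, Set.image_singleton, Ideal.span_singleton_mul_span_singleton, ← pow_two,
      tensorDiff_sq, Ideal.span_singleton_le_iff_mem]
    exact tensorDiff_mem_diffIdeal ⟨α, rfl⟩
  rw [Iq, Nat.add_sub_cancel, pow_succ, mul_smul]
  exact scharlauTransfer_mem_of_diffIdeal_pow_le s hs
    (scharlauTransfer_mem_fundamentalIdeal_smul hd s hs)
    (ideal_pow_succ_le_pow_sup
      ((diffIdeal_univ_eq_of_adjoin_eq_top hα).le.trans le_sup_left) hsq n) hx

theorem of_isPurelyInseparable [CharP F 2] [IsPurelyInseparable F L] :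
    TransferPreservesIq F L := by
  induction hn : Module.finrank F L using Nat.strong_induction_on generalizing F with | _ n ih
  have := charP_of_injective_algebraMap (algebraMap F L).injective 2
  by_cases hbot : (⊥ : IntermediateField F L) = ⊤
  · refine of_adjoin_sq (top_unique ?_)
    rw [← IntermediateField.top_toSubalgebra, ← hbot, IntermediateField.bot_toSubalgebra]
    exact bot_le
  obtain ⟨α, hα⟩ := SetLike.exists_not_mem_of_ne_top _ hbot rfl
  let E := IntermediateField.adjoin F {α}
  have : CharP E 2 := charP_of_injective_algebraMap (algebraMap F E).injective 2
  have : IsPurelyInseparable F E := IsPurelyInseparable.tower_bot F E L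
  have : IsPurelyInseparable E L := IsPurelyInseparable.tower_top F E L
  have hdegree : Module.finrank F E ≠ 1 :=
    mt IntermediateField.finrank_adjoin_simple_eq_one_iff.1 hα
  have heven : Even (Module.finrank F E) := by
    obtain ⟨k, hk⟩ := IsPurelyInseparable.finrank_eq_pow (F := F) E 2
    rw [hk] at hdegree ⊢
    exact Nat.even_pow.2 ⟨even_two, fun hk => hdegree (by rw [hk, pow_zero])⟩
  have hlt : Module.finrank E L < n := by
    rw [← hn, ← Module.finrank_mul_finrank F E L]
    exact lt_mul_left Module.finrank_pos
      (lt_of_le_of_ne (Nat.succ_le_of_lt Module.finrank_pos) hdegree.symm)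
  exact (of_isPurelyInseparable_of_adjoin_singleton heven
    (IntermediateField.adjoin.powerBasis
      (Algebra.IsIntegral.isIntegral α)).adjoin_gen_eq_top).trans (ih _ hlt rfl)

theorem of_finiteDimensional [CharP F 2] : TransferPreservesIq F L :=
  have := charP_of_injective_algebraMap (algebraMap F (separableClosure F L)).injective 2
  (of_isSeparable (L := separableClosure F L)).trans of_isPurelyInseparable

end TransferPreservesIq

end Filtration

end WittTheory

end

theorem lemma4p1_general.{u} {F L : Type u} [Field F] [Field L] [Algebra F L]
    [FiniteDimensional F L] [CharP F 2] (s : L →ₗ[F] F) (hs : s ≠ 0) (n : ℕ) :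
    WittTheory.scharlauTransfer s hs '' (WittTheory.Iq L (n + 1) : Set _) ⊆
      (WittTheory.Iq F (n + 1) : Set (WittTheory.QuadWitt F)) :=
  Set.image_subset_iff.2 (WittTheory.TransferPreservesIq.of_finiteDimensional s hs n)

theorem lemma4p1 {F : Type*} [Field F] [CharP F 2] {p : Polynomial F} [Fact (Irreducible p)]
    (hp : p.Monic) (m : ℕ) (hm : 1 ≤ m) :
    (WittTheory.polyTransfer hp) '' (WittTheory.Iq (AdjoinRoot p) m : Set _) ⊆
      (WittTheory.Iq F m : Set (WittTheory.QuadWitt F)) := by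
  obtain ⟨n, rfl⟩ := Nat.exists_eq_add_of_le' hm
  have := hp.finite_adjoinRoot
  exact lemma4p1_general _ _ n
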